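/- Let $R$ be a ring, $\mathrm{Mod}\,R$ the category of $R$-modules, $\mathrm{mod}\,R$ the finitely presented modules (viewed as complexes in degree $0$), and $\mathbf K=\mathbf K(\mathrm{Mod}\,R)$ the homotopy category of unbounded complexes of $R$-modules. A complex $X$ is *pure acyclic* if $\mathrm{Hom}_R(M,X)$ is acyclic for every $M\in\mathrm{mod}\,R$; let $\mathbf K_{\mathrm{pac}}\subset\mathbf K$ be the full subcategory of pure acyclic complexes, and let $Q\colon\mathbf K\to\mathbf D_{\mathrm{pure}}(R)=\mathbf K/\mathbf K_{\mathrm{pac}}$ be the Verdier quotient. An object of $\mathbf K$ is *homotopically pure-projective* if it lies in ${}^\perp\mathbf K_{\mathrm{pac}}=\{X:\mathrm{Hom}(X[n],\mathbf K_{\mathrm{pac}})=0\ \forall n\}$, and *homotopically pure-injective* if it lies in $\mathbf K_{\mathrm{pac}}^\perp=\{Y:\mathrm{Hom}(\mathbf K_{\mathrm{pac}},Y[n])=0\ \forall n\}$. A *pure quasi-isomorphism* is a chain map whose mapping cone is pure acyclic. A *pure-projective resolution* of $X$ is a pure quasi-isomorphism $P\to X$ with $P$ homotopically pure-projective; a *pure-injective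 resolution* of $X$ is a pure quasi-isomorphism $X\to I$ with $I$ homotopically pure-injective. $\mathrm{Loc}(\mathcal S)$ (resp. $\mathrm{Coloc}(\mathcal S)$) is the smallest isomorphism-closed triangulated subcategory that contains $\mathcal S$ and is closed under small coproducts (resp. products). A *stable t-structure* is a pair $(\mathcal U,\mathcal V)$ of isomorphism-closed full triangulated subcategories with $\mathrm{Hom}(\mathcal U,\mathcal V)=0$ such that every object $X$ lies in a triangle $U\to X\to V\to U[1]$ with $U\in\mathcal U$ and $V\in\mathcal V$. If $R$ is an algebra over a commutative ring $k$ and $I$ is an injective cogenerator of $\mathrm{Mod}\,k$, put $\nu=\mathrm{Hom}_k(\mathrm{Hom}_R(-,R),I)$. For $M\in\mathrm{mod}\,R$ choose an exact sequence of complexes $P_1\xrightarrow{p}P_0\to M\to 0$ with $P_0,P_1$ bounded contractible complexes of finitely generated projective modules, and set $\mathbb S M=\mathrm{Ker}(\nu(p))[2]$. Let $\mathbb S(\mathrm{mod}\,R)\subset\mathbf K$ be the class of all objects isomorphic in $\mathbf K$ to such an $\mathbb SM$. Then: 1. $(\mathrm{Loc}(\mathrm{mod}\,R),\mathbf K_{\mathrm{pac}})$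 is a stable t-structure in $\mathbf K$; $\mathrm{Loc}(\mathrm{mod}\,R)$ is the class of homotopically pure-projective objects; $Q$ restricts to an equivalence $\mathrm{Loc}(\mathrm{mod}\,R)\simeq\mathbf D_{\mathrm{pure}}(R)$; and $Q$ has a fully faithful left adjoint, whose essential image is the class of homotopically pure-projective objects. 2. For every commutative ring $k$, every $k$-algebra structure on $R$ and every injective cogenerator $I$ of $\mathrm{Mod}\,k$, the pair $(\mathbf K_{\mathrm{pac}},\mathrm{Coloc}(\mathbb S(\mathrm{mod}\,R)))$ is a stable t-structure in $\mathbf K$; $\mathrm{Coloc}(\mathbb S(\mathrm{mod}\,R))$ is the class of homotopically pure-injective objects; and $Q$ restricts to an equivalence $\mathrm{Coloc}(\mathbb S(\mathrm{mod}\,R))\simeq\mathbf D_{\mathrm{pure}}(R)$. Moreover $Q$ has a fully faithful right adjoint, whose essential image is the class of homotopically pure-injective objects. 3. Every complex of $R$-modules has a pure-projective resolution and a pure-injective resolution. -/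

import Mathlib

open CategoryTheory CategoryTheory.Limits CategoryTheory.Pretriangulated

universe w v u

namespace PureRes

/-! ### Stable t-structures, (co)localizing subcategories, orthogonals -/

section Triangulated

variable {T : Type u} [Category.{v} T] [HasZeroObject T] [HasShift T ℤ] [Preadditive T]
  [∀ n : ℤ, (shiftFunctor T n).Additive] [Pretriangulated T]

/-- A stable t-structure `(U, V)`: both classes are strictly full triangulated subcategories,
there are no nonzero morphisms from `U` to `V`, and each object `X` sits in a
distinguished triangle `A ⟶ X ⟶ B ⟶ A⟦1⟧` with `A` in `U` and `B` in `V`. -/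
structure IsStableTStructure (U V : ObjectProperty T) : Prop where
  left_isoClosed : U.IsClosedUnderIsomorphisms
  right_isoClosed : V.IsClosedUnderIsomorphisms
  left_triangulated : U.IsTriangulated
  right_triangulated : V.IsTriangulated
  hom_eq_zero : ∀ ⦃A B : T⦄, U A → V B → ∀ f : A ⟶ B, f = 0
  exists_triangle : ∀ X : T, ∃ (A B : T) (f : A ⟶ X) (g : X ⟶ B) (h : B ⟶ A⟦(1 : ℤ)⟧),
    U A ∧ V B ∧ Triangle.mk f g h ∈ distTriang T

/-- The smallest (strictly full) triangulated subcategory which contains `S` and is closed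
under small coproducts. -/
def Loc (S : ObjectProperty T) : ObjectProperty T := fun X =>
  ∀ P : ObjectProperty T, P.IsClosedUnderIsomorphisms → P.IsTriangulated →
    (∀ J : Type v, P.IsClosedUnderColimitsOfShape (Discrete J)) → S ≤ P → P X

/-- The smallest (strictly full) triangulated subcategory which contains `S` and is closed
under small products. -/
def Coloc (S : ObjectProperty T) : ObjectProperty T := fun X =>
  ∀ P : ObjectProperty T, P.IsClosedUnderIsomorphisms → P.IsTriangulated →
    (∀ J : Type v, P.IsClosedUnderLimitsOfShape (Discrete J)) → S ≤ P → P X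

/-- `⊥S`: the objects without nonzero morphisms from any of their shifts to an object of `S`. -/
def leftPerp (S : ObjectProperty T) : ObjectProperty T := fun X =>
  ∀ ⦃Y : T⦄, S Y → ∀ (n : ℤ) (f : X⟦n⟧ ⟶ Y), f = 0

/-- `S⊥`: the objects without nonzero morphisms from an object of `S` to any of their shifts. -/
def rightPerp (S : ObjectProperty T) : ObjectProperty T := fun Y =>
  ∀ ⦃X : T⦄, S X → ∀ (n : ℤ) (f : X ⟶ Y⟦n⟧), f = 0

end Triangulated

/-! ### Complexes of modules, pure acyclicity, the pure derived category -/

section Pure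

variable (R : Type u) [Ring R]

/-- Complexes of `R`-modules (cohomological grading by `ℤ`, unbounded). -/
abbrev Cplx := CochainComplex (ModuleCat.{u} R) ℤ

/-- The homotopy category `K(Mod R)`. -/
abbrev K := HomotopyCategory (ModuleCat.{u} R) (ComplexShape.up ℤ)

variable {R} in
/-- A complex `X` is pure acyclic if `Hom_R(M, X)` is acyclic for each finitely presented `M`. -/
def PureAcyclic (X : Cplx R) : Prop :=
  ∀ M : ModuleCat.{u} R, Module.FinitePresentation R M →
    (((preadditiveCoyoneda.obj (Opposite.op M)).mapHomologicalComplex (ComplexShape.up ℤ)).obj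
      X).Acyclic

/-- The subcategory of `K(Mod R)` formed by the pure acyclic complexes. -/
def Kpac : ObjectProperty (K R) := fun X => PureAcyclic X.as

/-- The pure derived category: the Verdier quotient of `K(Mod R)` by the pure acyclics, that is,
the localization at the morphisms whose cone is pure acyclic. -/
abbrev Dpure := (Kpac R).trW.Localization

/-- The natural quotient functor. -/
abbrev toDpure : K R ⥤ Dpure R := (Kpac R).trW.Q

/-- Homotopically pure-projective objects. -/
def HomotopicallyPureProjective : ObjectProperty (K R) := leftPerp (Kpac R)

/-- Homotopically pure-injective objects. -/
def HomotopicallyPureInjective : ObjectProperty (K R) := rightPerp (Kpac R)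

variable {R} in
/-- A chain map is a pure quasi-isomorphism if its mapping cone is pure acyclic. -/
def IsPureQuasiIso {X Y : Cplx R} (f : X ⟶ Y) : Prop :=
  PureAcyclic (CochainComplex.mappingCone f)

variable {R} in
/-- `f : P ⟶ X` is a pure-projective resolution of `X`. -/
def IsPureProjectiveResolution {P X : Cplx R} (f : P ⟶ X) : Prop :=
  IsPureQuasiIso f ∧
    HomotopicallyPureProjective R ((HomotopyCategory.quotient _ _).obj P)

variable {R} in
/-- `f : X ⟶ I` is a pure-injective resolution of `X`. -/
def IsPureInjectiveResolution {X I : Cplx R} (f : X ⟶ I) : Prop :=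
  IsPureQuasiIso f ∧
    HomotopicallyPureInjective R ((HomotopyCategory.quotient _ _).obj I)

/-- A module as a complex concentrated in degree `0`. -/
noncomputable abbrev stalk (M : ModuleCat.{u} R) : Cplx R :=
  (HomologicalComplex.single (ModuleCat.{u} R) (ComplexShape.up ℤ) 0).obj M

/-- `mod R` inside `K(Mod R)`: the objects isomorphic to a finitely presented module,
placed in degree `0`. -/
def finPres : ObjectProperty (K R) := fun X =>
  ∃ M : ModuleCat.{u} R, Module.FinitePresentation R M ∧
    Nonempty (X ≅ (HomotopyCategory.quotient _ _).obj (stalk R M))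

end Pure

/-! ### The Nakayama functor `ν = Hom_k(Hom_R(-, R), I)` -/

section Nakayama

variable {k : Type w} [CommRing k] {R : Type u} [Ring R] [Algebra k R]

/-- Right multiplication `φ ↦ φ · r` on `Hom_R(P, R)`, where `(φ · r) x = φ x * r`. -/
def dualRMul (k : Type w) [CommRing k] {R : Type u} [Ring R] [Algebra k R]
    (P : Type u) [AddCommGroup P] [Module R P] (r : R) :
    (P →ₗ[R] R) →ₗ[k] (P →ₗ[R] R) where
  toFun φ :=
    { toFun := fun x => φ x * r
      map_add' := fun x y => by simp [add_mul]
      map_smul' := fun a x => by simp [mul_assoc] }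
  map_add' φ ψ := by ext x; simp [add_mul]
  map_smul' c φ := by ext x; simp

/-- The underlying group of `ν P = Hom_k(Hom_R(P, R), I)`. -/
def NuCarrier (I : ModuleCat.{u} k) (P : ModuleCat.{u} R) : Type u :=
  (P →ₗ[R] R) →ₗ[k] I

instance (I : ModuleCat.{u} k) (P : ModuleCat.{u} R) : AddCommGroup (NuCarrier I P) :=
  inferInstanceAs (AddCommGroup ((P →ₗ[R] R) →ₗ[k] I))

/-- The left `R`-module structure `(r • f) φ = f (φ · r)`. -/
instance (I : ModuleCat.{u} k) (P : ModuleCat.{u} R) : Module R (NuCarrier I P) where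
  smul r f := LinearMap.comp (show (P →ₗ[R] R) →ₗ[k] I from f) (dualRMul k P r)
  one_smul f := by
    refine LinearMap.ext fun φ => ?_
    refine congrArg (show (P →ₗ[R] R) →ₗ[k] I from f) ?_
    ext x; simp [dualRMul]
  mul_smul r s f := by
    refine LinearMap.ext fun φ => ?_
    refine congrArg (show (P →ₗ[R] R) →ₗ[k] I from f) ?_
    ext x; simp [dualRMul, mul_assoc]
  smul_zero r := LinearMap.zero_comp _
  smul_add r f g := LinearMap.add_comp _ _ _
  add_smul r s f := by
    refine LinearMap.ext fun φ => ?_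
    refine Eq.trans (congrArg (show (P →ₗ[R] R) →ₗ[k] I from f)
      (show dualRMul k P (r + s) φ = dualRMul k P r φ + dualRMul k P s φ from ?_))
      (map_add (show (P →ₗ[R] R) →ₗ[k] I from f) _ _)
    ext x; simp [dualRMul, mul_add]
  zero_smul f := by
    refine LinearMap.ext fun φ => ?_
    refine Eq.trans (congrArg (show (P →ₗ[R] R) →ₗ[k] I from f)
      (show dualRMul k P (0 : R) φ = 0 from ?_))
      (map_zero (show (P →ₗ[R] R) →ₗ[k] I from f))
    ext x; simp [dualRMul]

/-- Precomposition `ψ ↦ ψ ∘ g`, as a `k`-linear map `Hom_R(Q, R) → Hom_R(P, R)`. -/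
def dualMap (k : Type w) [CommRing k] {R : Type u} [Ring R] [Algebra k R]
    {P Q : ModuleCat.{u} R} (g : P ⟶ Q) : (Q →ₗ[R] R) →ₗ[k] (P →ₗ[R] R) where
  toFun ψ := ψ.comp g.hom
  map_add' _ _ := rfl
  map_smul' _ _ := rfl

/-- The functor `ν = Hom_k(Hom_R(-, R), I) : Mod R ⥤ Mod R`. -/
def nu (R : Type u) [Ring R] [Algebra k R] (I : ModuleCat.{u} k) :
    ModuleCat.{u} R ⥤ ModuleCat.{u} R where
  obj P := ModuleCat.of R (NuCarrier I P)
  map {P Q} g := ModuleCat.ofHom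
    { toFun := fun f => LinearMap.comp (show (P →ₗ[R] R) →ₗ[k] I from f) (dualMap k g)
      map_add' := fun _ _ => rfl
      map_smul' := fun r f => by
        refine LinearMap.ext fun φ => ?_
        refine congrArg (show (P →ₗ[R] R) →ₗ[k] I from f) ?_
        rfl }
  map_id _ := rfl
  map_comp _ _ := rfl

instance (I : ModuleCat.{u} k) : (nu R I).Additive where
  map_add {P Q} {g h} := by
    ext f
    refine LinearMap.ext fun φ => ?_
    refine Eq.trans (congrArg (show (P →ₗ[R] R) →ₗ[k] I from f)
      (show dualMap k (g + h) φ = dualMap k g φ + dualMap k h φ from ?_))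
      (map_add (show (P →ₗ[R] R) →ₗ[k] I from f) _ _)
    ext x
    exact map_add φ _ _

/-- The functor `ν`, applied degreewise to complexes. -/
noncomputable abbrev nuCplx (R : Type u) [Ring R] [Algebra k R] (I : ModuleCat.{u} k) :
    Cplx R ⥤ Cplx R :=
  (nu R I).mapHomologicalComplex (ComplexShape.up ℤ)

end Nakayama

/-! ### The partial Serre functor `𝕊 M = Ker(ν p)[2]` -/

section Serre

/-- A bounded contractible complex of finitely generated projective modules. -/
structure IsContractibleProj {R : Type u} [Ring R] (P : Cplx R) : Prop where
  bounded : ∃ a b : ℤ, P.IsStrictlyGE a ∧ P.IsStrictlyLE b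
  finite : ∀ i : ℤ, Module.Finite R (P.X i)
  projective : ∀ i : ℤ, Module.Projective R (P.X i)
  contractible : Nonempty (Homotopy (𝟙 P) 0)

/-- A projective presentation `P₁ ⟶ P₀ ⟶ M ⟶ 0` of `M` in the category of bounded complexes of
finitely presented modules. -/
structure ProjPresentation {R : Type u} [Ring R] (M : Cplx R) where
  P₁ : Cplx R
  P₀ : Cplx R
  p : P₁ ⟶ P₀
  π : P₀ ⟶ M
  w : p ≫ π = 0
  proj₁ : IsContractibleProj P₁
  proj₀ : IsContractibleProj P₀
  epi : Epi π
  exact : (ShortComplex.mk p π w).Exact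

variable {k : Type w} [CommRing k] {R : Type u} [Ring R] [Algebra k R]

/-- `𝕊 M = Ker(ν p)[2]`, computed from a projective presentation of `M`. -/
noncomputable def ProjPresentation.serre {M : Cplx R} (p : ProjPresentation M)
    (I : ModuleCat.{u} k) : Cplx R :=
  (kernel ((nuCplx R I).map p.p))⟦(2 : ℤ)⟧

/-- The essential image `𝕊(mod R)` in `K(Mod R)`: all objects isomorphic to `𝕊 M`, for a finitely
presented module `M` and any choice of projective presentation of it. -/
def serreFinPres (R : Type u) [Ring R] [Algebra k R] (I : ModuleCat.{u} k) :
    ObjectProperty (K R) := fun X =>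
  ∃ M : ModuleCat.{u} R, Module.FinitePresentation R M ∧ ∃ p : ProjPresentation (stalk R M),
    Nonempty (X ≅ (HomotopyCategory.quotient _ _).obj (p.serre I))

end Serre

end PureRes

namespace PureRes

/-! ### Telescopes and truncation triangles in triangulated categories. -/

section TriangulatedTowers

variable {T : Type u} [Category.{v} T] [HasZeroObject T] [HasShift T ℤ] [Preadditive T]
  [∀ n : ℤ, (shiftFunctor T n).Additive] [Pretriangulated T]

/-! Since `H^p Hom(M, X)` is the group of maps in `K R` from `M`, placed in degree `p`, to `X`, the
pure acyclic complexes are the right orthogonal of the stalks of finitely presented modules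
(`kpac_iff`). Up to isomorphism these stalks form a set, stable under shifts. Coproducts in `K R`
are computed on complexes, so the stalks are compact (`finPresStalk_compact`).

For the first t-structure, kill all maps from stalks to `X` by the cone of a coproduct of stalks,
iterate, and take the telescope. By compactness nothing maps from a stalk to the telescope, so it is
pure acyclic. Comparison with the constant telescope on `X` shows that the fibre of the map from `X`
lies in `Loc (finPres R)` (`exists_triangle_of_compact`).

The second t-structure uses inverse towers of fibres of maps into products. Compactness is replaced
by a set of test objects: every nonzero map from a stalk to `X` stays nonzero after some map from
`X` to a test object (`exists_triangle_of_cogenerating`). The test objects are shifts of `Ker (ν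
p)`. For finitely generated projective `P`, a dual basis gives `Hom_R(Y, ν P) ≅ Hom_k(Hom_R(P, Y),
I)`, via `toNu`. Thus maps from `Y` to a component of `Ker (ν p)` are functionals on the cokernel of
`Hom(P₀, Y) → Hom(P₁, Y)`. Injectivity of `I` turns pure acyclicity of `X` into an extension
property (`exists_extension_to_ker_nu`), from which every map `X ⟶ Ker (ν p)` is null-homotopic,
degree by degree from below. Conversely, for a presentation by discs, `Ker (ν p)` is essentially
`Ker (ν g) → ν F₁ → ν F₀`, with `g : F₁ ⟶ F₀` presenting `M`; a functional on `Hom(M, X²)` that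
separates a cocycle from the coboundaries yields a chain map detecting its class
(`exists_comp_kernel_nu_ne_zero`).

The rest is formal: the two halves of a stable t-structure are each other's orthogonals, they give
the adjoints of the quotient functor, and the truncation triangles are the resolutions. For
statements without a base ring, `ℤ` and `ℚ/ℤ` serve. -/

lemma split_triangle_distinguished {A B C : T} (i : A ⟶ B) (q : B ⟶ C) (r : B ⟶ A) (t : C ⟶ B)
    (hir : i ≫ r = 𝟙 A) (htq : t ≫ q = 𝟙 C) (hiq : i ≫ q = 0) (htr : t ≫ r = 0)
    (h : r ≫ i + q ≫ t = 𝟙 B) :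
    Triangle.mk i q (0 : C ⟶ A⟦(1 : ℤ)⟧) ∈ distTriang T := by
  let e : B ≅ A ⊞ C := ⟨biprod.lift r q, biprod.desc i t, by simp [biprod.lift_desc, h], by
    ext <;> simp [hir, htq, hiq, htr]⟩
  refine isomorphic_distinguished _ (binaryBiproductTriangle_distinguished A C) _
    (Triangle.isoMk _ _ (Iso.refl _) e (Iso.refl _) ?_ ?_ ?_)
  · exact (biprod.hom_ext _ _ (by simp [e, hir]) (by simp [e, hiq]) :
      i ≫ e.hom = 𝟙 A ≫ biprod.inl)
  · exact (by simp [e] : q ≫ 𝟙 C = e.hom ≫ biprod.snd)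
  · exact (by simp : (0 : C ⟶ A⟦(1 : ℤ)⟧) ≫ (𝟙 A)⟦1⟧' = 𝟙 C ≫ 0)

/-- A class of objects closed under products has a stable class of morphisms with cone in it. -/
lemma trW_isStableUnderProductsOfShape (P : ObjectProperty T) (J : Type*)
    [HasProductsOfShape J T] [P.IsClosedUnderLimitsOfShape (Discrete J)] :
    P.trW.IsStableUnderProductsOfShape J := by
  refine MorphismProperty.IsStableUnderProductsOfShape.mk _ _ ?_
  intro X₁ X₂ _ _ f hf
  exact ObjectProperty.trW.mk _ (productTriangle_distinguished _
      (fun j => (hf j).choose_spec.choose_spec.choose_spec.choose))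
      (P.prop_pi _ (fun j => (hf j).choose_spec.choose_spec.choose_spec.choose_spec))

lemma trW_piMap (P : ObjectProperty T) (J : Type*)
    [HasProductsOfShape J T] [P.IsClosedUnderLimitsOfShape (Discrete J)]
    {X₁ X₂ : J → T} (f : ∀ j, X₁ j ⟶ X₂ j) (hf : ∀ j, P.trW (f j)) :
    P.trW (Limits.Pi.map f) :=
  have := trW_isStableUnderProductsOfShape P J
  MorphismProperty.limMap (W := P.trW) (X := Discrete.functor X₁) (Y := Discrete.functor X₂)
    (Discrete.natTrans (fun j => f j.as)) (fun j => hf j.as)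

-- This is the statement about products, read in the opposite category.
open Pretriangulated.Opposite Opposite in
lemma trW_sigmaMap (P : ObjectProperty T) [P.IsTriangulated] (J : Type*)
    [HasCoproductsOfShape J T] [P.IsClosedUnderColimitsOfShape (Discrete J)]
    {X₁ X₂ : J → T} (f : ∀ j, X₁ j ⟶ X₂ j) (hf : ∀ j, P.trW (f j)) :
    P.trW (Limits.Sigma.map f) := by
  have : P.op.IsClosedUnderLimitsOfShape (Discrete J) :=
    .of_equivalence (P := P.op) (Discrete.opposite J)
  have := trW_isStableUnderProductsOfShape P.op J
  have h := this.condition (Discrete.functor fun j => op (X₂ j)) (Discrete.functor fun j => op (X₁ j))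
    (Cofan.op (Cofan.mk _ (Sigma.ι X₂))) (Cofan.op (Cofan.mk _ (Sigma.ι X₁)))
    (Cofan.IsColimit.op (coproductIsCoproduct X₂)) (Cofan.IsColimit.op (coproductIsCoproduct X₁))
    (Discrete.natTrans (fun j => (f j.as).op))
    (fun j => by
      rw [ObjectProperty.trW_op]
      exact hf j.as) (Limits.Sigma.map f).op (fun j => by
        apply Quiver.Hom.unop_inj
        simp)
  rw [ObjectProperty.trW_op] at h
  exact h

/-- After `s`, every map from a `C j` to `A` vanishes, so `𝟙 - s` acts on such maps as the identity.
Shift-stability of the family gives the same for `A⟦1⟧`, and the long exact sequence leaves nothing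
for the cone. -/
lemma eq_zero_of_isTower {ι : Type*} (C : ι → T) (hC : ∀ j, ∃ j', Nonempty (C j ≅ (C j')⟦(1 : ℤ)⟧))
    {A W : T} (s : A ⟶ A) (hs : ∀ (j) (f : C j ⟶ A), f ≫ s = 0) (q : A ⟶ W) (δ : W ⟶ A⟦(1 : ℤ)⟧)
    (hT : Triangle.mk (𝟙 A - s) q δ ∈ distTriang T) (j : ι) (f : C j ⟶ W) : f = 0 := by
  obtain ⟨j', ⟨e⟩⟩ := hC j
  have hδ : f ≫ δ = 0 := by
    obtain ⟨g, hg⟩ := (shiftFunctor T (1 : ℤ)).map_surjective (e.inv ≫ f ≫ δ)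
    have h₁ : δ ≫ (𝟙 A - s)⟦(1 : ℤ)⟧' = 0 := comp_distTriang_mor_zero₃₁ _ hT
    have h₂ : δ = δ ≫ s⟦(1 : ℤ)⟧' := by
      simpa only [Functor.map_sub, CategoryTheory.Functor.map_id, Preadditive.comp_sub, Category.comp_id,
        sub_eq_zero] using h₁
    have h₃ : f ≫ δ = e.hom ≫ g⟦(1 : ℤ)⟧' := by simp [hg]
    rw [h₂, ← Category.assoc, h₃, Category.assoc, ← Functor.map_comp, hs, Functor.map_zero,
      comp_zero]
  obtain ⟨g, hg⟩ : ∃ g : C j ⟶ A, f = g ≫ q := Triangle.coyoneda_exact₃ _ hT f hδ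
  have h₁ : (𝟙 A - s) ≫ q = 0 := comp_distTriang_mor_zero₁₂ _ hT
  have h₂ : g ≫ (𝟙 A - s) = g := by simp [hs]
  rw [hg, ← h₂, Category.assoc, h₁, comp_zero]

/-- The telescope of a constant sequence is its value. The retraction of `𝟙 - shift` consists of
negative partial sums, obtained by telescoping. -/
lemma sigma_const_triangle_distinguished [HasCoproductsOfShape ℕ T] (X : T) :
    Triangle.mk (𝟙 (∐ fun _ : ℕ => X) - Sigma.desc (fun n => Sigma.ι (fun _ : ℕ => X) (n + 1)))
      (Sigma.desc fun _ => 𝟙 X) (0 : X ⟶ (∐ fun _ : ℕ => X)⟦(1 : ℤ)⟧) ∈ distTriang T := by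
  refine split_triangle_distinguished _ _
    (Sigma.desc fun n => -∑ i ∈ Finset.range n, Sigma.ι (fun _ : ℕ => X) i)
    (Sigma.ι (fun _ : ℕ => X) 0) ?_ ?_ ?_ ?_ ?_
  · ext n
    simp [Finset.sum_range_succ]
  · simp
  · ext n
    simp
  · simp
  · ext n
    simp only [Preadditive.comp_add, colimit.ι_desc_assoc, Cofan.mk_ι_app, Preadditive.comp_sub,
      Category.comp_id, Preadditive.neg_comp, Preadditive.sum_comp, colimit.ι_desc]
    have h := Finset.sum_range_sub' (fun i => Sigma.ι (fun _ : ℕ => X) i) n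
    rw [Finset.sum_sub_distrib] at h
    rw [neg_sub_neg, ← neg_sub, h]
    simp

lemma pi_const_triangle_distinguished [HasProductsOfShape ℕ T] (X : T) :
    Triangle.mk (Pi.lift fun _ : ℕ => 𝟙 X)
      (𝟙 (∏ᶜ fun _ : ℕ => X) - Pi.lift (fun n => Pi.π (fun _ : ℕ => X) (n + 1)))
      (0 : (∏ᶜ fun _ : ℕ => X) ⟶ X⟦(1 : ℤ)⟧) ∈ distTriang T := by
  refine split_triangle_distinguished _ _ (Pi.π (fun _ : ℕ => X) 0)
    (Pi.lift fun n => -∑ i ∈ Finset.range n, Pi.π (fun _ : ℕ => X) i) ?_ ?_ ?_ ?_ ?_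
  · simp
  · ext n
    simp [Finset.sum_range_succ]
  · ext n
    simp
  · simp
  · ext n
    simp only [Preadditive.add_comp, Category.assoc, limit.lift_π, Fan.mk_π_app,
      Preadditive.sub_comp, Category.comp_id, Preadditive.comp_neg, Preadditive.comp_sum,
      Category.id_comp]
    have h := Finset.sum_range_sub' (fun i => Pi.π (fun _ : ℕ => X) i) n
    rw [Finset.sum_sub_distrib] at h
    rw [neg_sub_neg, ← neg_sub, h]
    simp

lemma exists_trW_of_colim_tower [IsTriangulated T] (P : ObjectProperty T) [P.IsTriangulated]
    [HasCoproductsOfShape ℕ T] [P.IsClosedUnderColimitsOfShape (Discrete ℕ)]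
    {ι : Type*} (C : ι → T) (hC : ∀ j, ∃ j', Nonempty (C j ≅ (C j')⟦(1 : ℤ)⟧))
    (X : ℕ → T) (φ : ∀ n, X n ⟶ X (n + 1)) (hφ : ∀ n, P.trW (φ n))
    (hcomp : ∀ j (f : C j ⟶ ∐ X),
      ∃ (s : Finset ℕ) (g : ∀ n, C j ⟶ X n), f = ∑ n ∈ s, g n ≫ Sigma.ι X n)
    (hCφ : ∀ n j (f : C j ⟶ X n), f ≫ φ n = 0) :
    ∃ (V : T) (c : X 0 ⟶ V), P.trW c ∧ ∀ j (f : C j ⟶ V), f = 0 := by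
  let s : ∐ X ⟶ ∐ X := Sigma.desc (fun n => φ n ≫ Sigma.ι X (n + 1))
  obtain ⟨V, q, δ, hT⟩ := distinguished_cocone_triangle (𝟙 _ - s)
  have hs : ∀ j (f : C j ⟶ ∐ X), f ≫ s = 0 := by
    intro j f
    obtain ⟨t, g, rfl⟩ := hcomp j f
    rw [Preadditive.sum_comp]
    refine Finset.sum_eq_zero fun n _ => ?_
    simp [s, reassoc_of% (hCφ n j (g n))]
  let ψ : ∀ n, X 0 ⟶ X n := fun n => Nat.rec (𝟙 _) (fun n f => f ≫ φ n) n
  have hψ : ∀ n, ψ (n + 1) = ψ n ≫ φ n := fun n => rfl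
  have hψW : ∀ n, P.trW (ψ n) := by
    intro n
    induction n with
    | zero => exact MorphismProperty.id_mem _ _
    | succ n ih => exact P.trW.comp_mem _ _ ih (hφ n)
  have ha : P.trW (Limits.Sigma.map ψ) := trW_sigmaMap P ℕ ψ hψW
  -- The composites `ψ n` map the constant telescope on `X 0` to the given one. The two vertical
  -- maps on coproducts have cone in `P`, so a third one can be chosen with the same property.
  obtain ⟨c, hc, -, -⟩ := MorphismProperty.IsCompatibleWithTriangulation.compatible_with_triangulation
    (W := P.trW) _ _ (sigma_const_triangle_distinguished (X 0)) hT _ _ ha ha (by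
      refine Sigma.hom_ext (X := ∐ X) _ _ fun n => ?_
      change Sigma.ι (fun _ : ℕ => X 0) n ≫ (𝟙 _ - _) ≫ Limits.Sigma.map ψ =
        Sigma.ι (fun _ : ℕ => X 0) n ≫ Limits.Sigma.map ψ ≫ (𝟙 _ - s)
      simp [s, hψ])
  exact ⟨V, c, hc, eq_zero_of_isTower C hC s hs q δ hT⟩

lemma exists_trW_of_lim_tower [IsTriangulated T] (P : ObjectProperty T) [P.IsTriangulated]
    [HasProductsOfShape ℕ T] [P.IsClosedUnderLimitsOfShape (Discrete ℕ)]
    {ι : Type*} (C : ι → T) (hC : ∀ j, ∃ j', Nonempty (C j ≅ (C j')⟦(1 : ℤ)⟧))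
    (X : ℕ → T) (φ : ∀ n, X (n + 1) ⟶ X n) (hφ : ∀ n, P.trW (φ n))
    (hCφ : ∀ n j (f : C j ⟶ X (n + 1)), f ≫ φ n = 0) :
    ∃ (V : T) (c : V ⟶ (X 0)⟦(1 : ℤ)⟧), P.trW c ∧ ∀ j (f : C j ⟶ V), f = 0 := by
  let s : ∏ᶜ X ⟶ ∏ᶜ X := Pi.lift (fun n => Pi.π X (n + 1) ≫ φ n)
  obtain ⟨V, q, δ, hT⟩ := distinguished_cocone_triangle (𝟙 _ - s)
  have hs : ∀ j (f : C j ⟶ ∏ᶜ X), f ≫ s = 0 := by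
    intro j f
    refine Pi.hom_ext _ _ fun n => ?_
    simpa [s] using hCφ n j (f ≫ Pi.π X (n + 1))
  let ψ : ∀ n, X n ⟶ X 0 := fun n => Nat.rec (𝟙 _) (fun n f => φ n ≫ f) n
  have hψ : ∀ n, ψ (n + 1) = φ n ≫ ψ n := fun n => rfl
  have hψW : ∀ n, P.trW (ψ n) := by
    intro n
    induction n with
    | zero => exact MorphismProperty.id_mem _ _
    | succ n ih => exact P.trW.comp_mem _ _ (hφ n) ih
  have ha : P.trW (Limits.Pi.map ψ) := trW_piMap P ℕ ψ hψW
  -- `V` is the cone, not the fibre, of `𝟙 - s`. The constant triangle is therefore rotated, and its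
  -- third vertex is `(X 0)⟦1⟧`.
  obtain ⟨c, hc, -, -⟩ := MorphismProperty.IsCompatibleWithTriangulation.compatible_with_triangulation
    (W := P.trW) _ _ hT (rot_of_distTriang _ (pi_const_triangle_distinguished (X 0))) _ _ ha ha (by
      refine Pi.hom_ext (X := ∏ᶜ X) _ _ fun n => ?_
      change ((𝟙 _ - s) ≫ Limits.Pi.map ψ) ≫ Pi.π (fun _ : ℕ => X 0) n =
        (Limits.Pi.map ψ ≫ (𝟙 _ - _)) ≫ Pi.π (fun _ : ℕ => X 0) n
      simp [s, hψ])
  exact ⟨V, c, hc, eq_zero_of_isTower C hC s hs q δ hT⟩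

/-- One step of the tower: the cone of the sum of all maps from the `C j` kills each of them. -/
lemma exists_trW_comp_eq_zero (P : ObjectProperty T) [P.IsTriangulated] [HasCoproducts.{v} T]
    (hP : ∀ J : Type v, P.IsClosedUnderColimitsOfShape (Discrete J))
    {ι : Type v} (C : ι → T) (hCP : ∀ j, P (C j)) (X : T) :
    ∃ (X' : T) (φ : X ⟶ X'), P.trW φ ∧ ∀ j (f : C j ⟶ X), f ≫ φ = 0 := by
  let J := Σ j, (C j ⟶ X)
  let a : (∐ fun t : J => C t.1) ⟶ X := Sigma.desc fun t => t.2
  obtain ⟨X', φ, δ, hT⟩ := distinguished_cocone_triangle a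
  have h₁ : a ≫ φ = 0 := comp_distTriang_mor_zero₁₂ _ hT
  refine ⟨X', φ, ObjectProperty.trW.mk' P hT (P.prop_colimit _ fun t => hCP _), fun j f => ?_⟩
  have : f = Sigma.ι (fun t : J => C t.1) ⟨j, f⟩ ≫ a := by simp [a]
  rw [this, Category.assoc, h₁, comp_zero]

lemma exists_trW_eq_zero_comp (P : ObjectProperty T) [P.IsTriangulated] [HasProducts.{v} T]
    (hP : ∀ J : Type v, P.IsClosedUnderLimitsOfShape (Discrete J))
    {ι : Type v} (D : ι → T) (hDP : ∀ j, P (D j)) (X : T) :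
    ∃ (X' : T) (φ : X' ⟶ X), P.trW φ ∧ ∀ j (f : X ⟶ D j), φ ≫ f = 0 := by
  let J := Σ j, (X ⟶ D j)
  let a : X ⟶ (∏ᶜ fun t : J => D t.1) := Pi.lift fun t => t.2
  obtain ⟨X', φ, δ, hT⟩ := distinguished_cocone_triangle₁ a
  have h₁ : φ ≫ a = 0 := comp_distTriang_mor_zero₁₂ _ hT
  refine ⟨X', φ, ObjectProperty.trW.mk P hT (P.prop_limit _ fun t => hDP _), fun j f => ?_⟩
  have : f = a ≫ Pi.π (fun t : J => D t.1) ⟨j, f⟩ := by simp [a]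
  rw [this, ← Category.assoc, h₁, zero_comp]

/-- If `P` is a localizing subcategory containing a shift-stable set of compact objects, then
each object has a triangle with first term in `P` and third term orthogonal to this set. -/
lemma exists_triangle_of_compact [IsTriangulated T] (P : ObjectProperty T) [P.IsTriangulated]
    [P.IsClosedUnderIsomorphisms] [HasCoproducts.{v} T]
    (hP : ∀ J : Type v, P.IsClosedUnderColimitsOfShape (Discrete J))
    {ι : Type v} (C : ι → T) (hCP : ∀ j, P (C j))
    (hC : ∀ j, ∃ j', Nonempty (C j ≅ (C j')⟦(1 : ℤ)⟧))
    [HasCoproductsOfShape ℕ T]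
    (hcomp : ∀ (X : ℕ → T) j (f : C j ⟶ ∐ X),
      ∃ (s : Finset ℕ) (g : ∀ n, C j ⟶ X n), f = ∑ n ∈ s, g n ≫ Sigma.ι X n) (X : T) :
    ∃ (A B : T) (f : A ⟶ X) (g : X ⟶ B) (h : B ⟶ A⟦(1 : ℤ)⟧),
      P A ∧ (∀ j (f : C j ⟶ B), f = 0) ∧ Triangle.mk f g h ∈ distTriang T := by
  have : P.IsClosedUnderColimitsOfShape (Discrete ℕ) :=
    have := hP (ULift.{v} ℕ)
    .of_equivalence (P := P) (Discrete.equivalence Equiv.ulift.{v})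
  choose S φ hφ hCφ using exists_trW_comp_eq_zero P hP C hCP
  let Y : ℕ → T := fun n => Nat.rec X (fun _ Z => S Z) n
  obtain ⟨V, c, hc, hV⟩ := exists_trW_of_colim_tower P C hC Y (fun n => φ (Y n))
    (fun n => hφ _) (hcomp Y) (fun n => hCφ (Y n))
  rw [ObjectProperty.trW_iff'] at hc
  obtain ⟨A, f, h, hT, hA⟩ := hc
  exact ⟨A, V, f, c, h, hA, hV, hT⟩

/-- If `P` is a colocalizing subcategory which contains a set of objects detecting the
nonzero maps from a shift-stable set of objects, then each object has a triangle with
third term in `P` and first term orthogonal to this set. -/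
lemma exists_triangle_of_cogenerating [IsTriangulated T] (P : ObjectProperty T)
    [P.IsTriangulated] [P.IsClosedUnderIsomorphisms] [HasProducts.{v} T]
    (hP : ∀ J : Type v, P.IsClosedUnderLimitsOfShape (Discrete J))
    {ι κ : Type v} (C : ι → T) (D : κ → T) (hDP : ∀ j, P (D j))
    (hC : ∀ j, ∃ j', Nonempty (C j ≅ (C j')⟦(1 : ℤ)⟧))
    (hCD : ∀ (X : T) j (f : C j ⟶ X), f ≠ 0 → ∃ (t : κ) (g : X ⟶ D t), f ≫ g ≠ 0) (X : T) :
    ∃ (A B : T) (f : A ⟶ X) (g : X ⟶ B) (h : B ⟶ A⟦(1 : ℤ)⟧),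
      (∀ j (f : C j ⟶ A), f = 0) ∧ P B ∧ Triangle.mk f g h ∈ distTriang T := by
  have : P.IsClosedUnderLimitsOfShape (Discrete ℕ) :=
    have := hP (ULift.{v} ℕ)
    .of_equivalence (P := P) (Discrete.equivalence Equiv.ulift.{v})
  have : HasProductsOfShape ℕ T :=
    hasLimitsOfShape_of_equivalence (Discrete.equivalence Equiv.ulift.{v})
  choose S φ hφ hφD using exists_trW_eq_zero_comp P hP D hDP
  -- The tower starts at `X⟦-1⟧` because its limit construction yields a map to the shift of the
  -- starting object.
  let Y : ℕ → T := fun n => Nat.rec (X⟦(-1 : ℤ)⟧) (fun _ Z => S Z) n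
  obtain ⟨V, c, hc, hV⟩ := exists_trW_of_lim_tower P C hC Y (fun n => φ (Y n))
    (fun n => hφ _) (fun n j f => by
      -- A nonzero composite would be detected by some map to a `D t`, but `φ` annihilates every
      -- such map.
      by_contra hf
      obtain ⟨t, g, hg⟩ := hCD _ j _ hf
      exact hg (by rw [Category.assoc, hφD, comp_zero]))
  let e : (Y 0)⟦(1 : ℤ)⟧ ≅ X := (shiftEquiv T (1 : ℤ)).counitIso.app X
  have hce : P.trW (c ≫ e.hom) := (P.trW.cancel_right_of_respectsIso _ _).2 hc
  obtain ⟨B, g, h, hT, hB⟩ := hce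
  exact ⟨V, B, c ≫ e.hom, g, h, hV, hB, hT⟩

end TriangulatedTowers

/-! ### Adjoints of a functor that is an equivalence on a subcategory. -/

section Adjoints

variable {T D : Type*} [Category* T] [Category* D] (Q : T ⥤ D) (U : ObjectProperty T)
  [U.IsClosedUnderIsomorphisms] [(U.ι ⋙ Q).IsEquivalence]

/-- The adjoint is a quasi-inverse of the restricted equivalence followed by the inclusion of `U`.
Bijectivity on maps out of `U` is the adjunction bijection. -/
lemma exists_leftAdjoint_of_bijective
    (h : ∀ ⦃X : T⦄, U X → ∀ Y : T, Function.Bijective (Q.map : (X ⟶ Y) → _)) :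
    ∃ L : D ⥤ T, Nonempty (L ⊣ Q) ∧ L.Full ∧ L.Faithful ∧ L.essImage = U := by
  let e := (U.ι ⋙ Q).asEquivalence
  let L : D ⥤ T := e.inverse ⋙ U.ι
  have hL : ∀ Y, U (L.obj Y) := fun Y => (e.inverse.obj Y).property
  let c : ∀ Y, Q.obj (L.obj Y) ≅ Y := fun Y => e.counitIso.app Y
  have hc : ∀ {Y Y' : D} (f : Y ⟶ Y'), Q.map (L.map f) ≫ (c Y').hom = (c Y).hom ≫ f :=
    fun f => e.counitIso.hom.naturality f
  let eq : ∀ Y X, (L.obj Y ⟶ X) ≃ (Y ⟶ Q.obj X) := fun Y X =>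
    (Equiv.ofBijective _ (h (hL Y) X)).trans ((c Y).homFromEquiv)
  have heq : ∀ Y X (f : L.obj Y ⟶ X), eq Y X f = (c Y).inv ≫ Q.map f := fun Y X f => rfl
  refine ⟨L, ⟨Adjunction.mkOfHomEquiv ⟨eq, ?_, ?_⟩⟩, inferInstance, inferInstance, ?_⟩
  · intro Y' Y X f g
    apply (eq Y' X).injective
    have h₁ : (c Y).inv ≫ Q.map ((eq Y X).symm g) = g := (eq Y X).apply_symm_apply g
    rw [Equiv.apply_symm_apply, heq, Functor.map_comp, ← Category.assoc,
      (by rw [Iso.inv_comp_eq, ← Category.assoc, ← hc]; simp :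
        (c Y').inv ≫ Q.map (L.map f) = f ≫ (c Y).inv), Category.assoc, h₁]
  · intro Y X X' f g
    simp [heq]
  · ext X
    refine ⟨fun ⟨Y, ⟨i⟩⟩ => U.prop_of_iso i (hL Y), fun hX => ⟨Q.obj X, ⟨?_⟩⟩⟩
    exact U.ι.mapIso (e.unitIso.symm.app ⟨X, hX⟩)

lemma exists_rightAdjoint_of_bijective
    (h : ∀ ⦃Y : T⦄, U Y → ∀ X : T, Function.Bijective (Q.map : (X ⟶ Y) → _)) :
    ∃ G : D ⥤ T, Nonempty (Q ⊣ G) ∧ G.Full ∧ G.Faithful ∧ G.essImage = U := by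
  let e := (U.ι ⋙ Q).asEquivalence
  let G : D ⥤ T := e.inverse ⋙ U.ι
  have hG : ∀ Y, U (G.obj Y) := fun Y => (e.inverse.obj Y).property
  let c : ∀ Y, Q.obj (G.obj Y) ≅ Y := fun Y => e.counitIso.app Y
  have hc : ∀ {Y Y' : D} (f : Y ⟶ Y'), Q.map (G.map f) ≫ (c Y').hom = (c Y).hom ≫ f :=
    fun f => e.counitIso.hom.naturality f
  let eq : ∀ X Y, (X ⟶ G.obj Y) ≃ (Q.obj X ⟶ Y) := fun X Y =>
    (Equiv.ofBijective _ (h (hG Y) X)).trans ((c Y).homToEquiv)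
  have heq : ∀ X Y (f : X ⟶ G.obj Y), eq X Y f = Q.map f ≫ (c Y).hom := fun X Y f => rfl
  refine ⟨G, ⟨Adjunction.mkOfHomEquiv ⟨fun X Y => (eq X Y).symm, ?_, ?_⟩⟩,
    inferInstance, inferInstance, ?_⟩
  · intro X' X Y f g
    simp [heq]
  · intro X Y Y' f g
    apply (eq X Y').injective
    have h₁ : Q.map ((eq X Y).symm f) ≫ (c Y).hom = f := (eq X Y).apply_symm_apply f
    rw [Equiv.apply_symm_apply, heq, Functor.map_comp, Category.assoc, hc, ← Category.assoc, h₁]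
  · ext X
    refine ⟨fun ⟨Y, ⟨i⟩⟩ => U.prop_of_iso i (hG Y), fun hX => ⟨Q.obj X, ⟨?_⟩⟩⟩
    exact U.ι.mapIso (e.unitIso.symm.app ⟨X, hX⟩)

end Adjoints

/-! ### Formal consequences of a stable t-structure. -/

section Triangulated

section

variable {T : Type u} [Category.{v} T] [HasShift T ℤ] [Preadditive T]

lemma leftPerp_eq_leftOrthogonal (S : ObjectProperty T) [S.IsStableUnderShift ℤ] :
    leftPerp S = S.leftOrthogonal := by
  ext X
  refine ⟨fun h Y f hY => ?_, fun h Y hY n f => ?_⟩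
  · have := h hY 0 ((shiftFunctorZero T ℤ).hom.app X ≫ f)
    rwa [← cancel_epi ((shiftFunctorZero T ℤ).hom.app X), comp_zero]
  · exact (S.leftOrthogonal.le_shift n _ h) f hY

lemma rightPerp_eq_rightOrthogonal (S : ObjectProperty T) [S.IsStableUnderShift ℤ] :
    rightPerp S = S.rightOrthogonal := by
  ext X
  refine ⟨fun h Y f hY => ?_, fun h Y hY n f => ?_⟩
  · have := h hY 0 (f ≫ (shiftFunctorZero T ℤ).inv.app X)
    rwa [← cancel_mono ((shiftFunctorZero T ℤ).inv.app X), zero_comp]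
  · exact (S.rightOrthogonal.le_shift n _ h) f hY

end

variable {T : Type u} [Category.{v} T] [HasZeroObject T] [HasShift T ℤ] [Preadditive T]
  [∀ n : ℤ, (shiftFunctor T n).Additive] [Pretriangulated T]

namespace IsStableTStructure

variable {U V : ObjectProperty T} (h : IsStableTStructure U V)
include h

/-- If `X` is orthogonal to `V`, then `X ⟶ B` vanishes, so `𝟙 B` factors through `A⟦1⟧`. Maps from
`U` to `V` being zero, `B = 0` and `A ≅ X`. -/
lemma left_eq_leftOrthogonal : U = V.leftOrthogonal := by
  ext X
  refine ⟨fun hX Y f hY => h.hom_eq_zero hX hY f, fun hX => ?_⟩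
  obtain ⟨A, B, f, g, d, hA, hB, hT⟩ := h.exists_triangle X
  have := h.left_isoClosed
  have := h.right_isoClosed
  have := h.left_triangulated
  have := h.right_triangulated
  have hg : g = 0 := hX g hB
  obtain ⟨r, hr⟩ : ∃ r : A⟦(1 : ℤ)⟧ ⟶ B, 𝟙 B = d ≫ r :=
    Triangle.yoneda_exact₃ _ hT (𝟙 B) (by change g ≫ 𝟙 B = 0; rw [hg, zero_comp])
  have hr0 : r = 0 := h.hom_eq_zero (U.le_shift 1 _ hA) hB r
  have hB0 : IsZero B := by rw [IsZero.iff_id_eq_zero, hr, hr0, comp_zero]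
  have : IsIso f := (Triangle.isZero₃_iff_isIso₁ _ hT).1 hB0
  exact U.prop_of_iso (asIso f) hA

lemma right_eq_rightOrthogonal : V = U.rightOrthogonal := by
  ext X
  refine ⟨fun hX Y f hY => h.hom_eq_zero hY hX f, fun hX => ?_⟩
  obtain ⟨A, B, f, g, d, hA, hB, hT⟩ := h.exists_triangle X
  have := h.left_isoClosed
  have := h.right_isoClosed
  have := h.left_triangulated
  have := h.right_triangulated
  have hf : f = 0 := hX f hA
  obtain ⟨r, hr⟩ : ∃ r : A ⟶ B⟦(-1 : ℤ)⟧, 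
      𝟙 A = r ≫ (show B⟦(-1 : ℤ)⟧ ⟶ A from (Triangle.mk f g d).invRotate.mor₁) :=
    Triangle.coyoneda_exact₂ _ (inv_rot_of_distTriang _ hT) (𝟙 A)
      (by change 𝟙 A ≫ f = 0; rw [hf, comp_zero])
  have hr0 : r = 0 := h.hom_eq_zero hA (V.le_shift (-1) _ hB) r
  have hA0 : IsZero A := by
    rw [IsZero.iff_id_eq_zero, hr, hr0]
    exact zero_comp
  have : IsIso g := (Triangle.isZero₁_iff_isIso₂ _ hT).1 hA0
  exact V.prop_of_iso (asIso g).symm hB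

lemma left_eq_leftPerp : U = leftPerp V := by
  have := h.right_triangulated
  rw [leftPerp_eq_leftOrthogonal]
  exact h.left_eq_leftOrthogonal

lemma right_eq_rightPerp : V = rightPerp U := by
  have := h.left_triangulated
  rw [rightPerp_eq_rightOrthogonal]
  exact h.right_eq_rightOrthogonal

variable [IsTriangulated T]

lemma map_bijective_of_left ⦃X : T⦄ (hX : U X) (Y : T) :
    Function.Bijective (V.trW.Q.map : (X ⟶ Y) → _) := by
  have := h.right_triangulated
  rw [h.left_eq_leftOrthogonal] at hX
  exact hX.map_bijective_of_isTriangulated V.trW.Q Y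

lemma map_bijective_of_right ⦃Y : T⦄ (hY : V Y) (X : T) :
    Function.Bijective (U.trW.Q.map : (X ⟶ Y) → _) := by
  have := h.left_triangulated
  rw [h.right_eq_rightOrthogonal] at hY
  exact hY.map_bijective_of_isTriangulated U.trW.Q X

lemma isEquivalence_left : (U.ι ⋙ V.trW.Q).IsEquivalence where
  faithful := ⟨fun {X Y} f g hfg => U.ι.map_injective
    ((h.map_bijective_of_left X.property _).injective hfg)⟩
  full := ⟨fun {X Y} f => by
    obtain ⟨g, hg⟩ := (h.map_bijective_of_left X.property _).surjective f
    exact ⟨U.fullyFaithfulι.preimage g, by simpa using hg⟩⟩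
  essSurj := ⟨fun Z => by
    have : V.trW.Q.EssSurj := Localization.essSurj V.trW.Q V.trW
    obtain ⟨A, B, f, g, d, hA, hB, hT⟩ := h.exists_triangle (V.trW.Q.objPreimage Z)
    have := Localization.inverts V.trW.Q V.trW f ⟨_, _, _, hT, hB⟩
    exact ⟨⟨A, hA⟩, ⟨asIso (V.trW.Q.map f) ≪≫ V.trW.Q.objObjPreimageIso Z⟩⟩⟩

lemma isEquivalence_right : (V.ι ⋙ U.trW.Q).IsEquivalence where
  faithful := ⟨fun {X Y} f g hfg => V.ι.map_injective
    ((h.map_bijective_of_right Y.property _).injective hfg)⟩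
  full := ⟨fun {X Y} f => by
    obtain ⟨g, hg⟩ := (h.map_bijective_of_right Y.property _).surjective f
    exact ⟨V.fullyFaithfulι.preimage g, by simpa using hg⟩⟩
  essSurj := ⟨fun Z => by
    have := h.left_triangulated
    have : U.trW.Q.EssSurj := Localization.essSurj U.trW.Q U.trW
    obtain ⟨A, B, f, g, d, hA, hB, hT⟩ := h.exists_triangle (U.trW.Q.objPreimage Z)
    have := Localization.inverts U.trW.Q U.trW g
      ((U.trW_iff' g).2 ⟨_, _, _, hT, hA⟩)
    exact ⟨⟨B, hB⟩, ⟨(asIso (U.trW.Q.map g)).symm ≪≫ U.trW.Q.objObjPreimageIso Z⟩⟩⟩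

lemma exists_leftAdjoint : ∃ L : V.trW.Localization ⥤ T, Nonempty (L ⊣ V.trW.Q) ∧
    L.Full ∧ L.Faithful ∧ L.essImage = U := by
  have := h.left_isoClosed
  have := h.isEquivalence_left
  exact exists_leftAdjoint_of_bijective _ U h.map_bijective_of_left

lemma exists_rightAdjoint : ∃ G : U.trW.Localization ⥤ T, Nonempty (U.trW.Q ⊣ G) ∧
    G.Full ∧ G.Faithful ∧ G.essImage = V := by
  have := h.right_isoClosed
  have := h.isEquivalence_right
  exact exists_rightAdjoint_of_bijective _ V h.map_bijective_of_right

end IsStableTStructure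

/-! ### Closure properties of localizing and colocalizing subcategories. -/

section Localizing

variable (S : ObjectProperty T)

lemma le_loc : S ≤ Loc S := fun _ hX _ _ _ _ hS => hS _ hX

lemma le_coloc : S ≤ Coloc S := fun _ hX _ _ _ _ hS => hS _ hX

instance : (Loc S).IsClosedUnderIsomorphisms where
  of_iso e hX P h₁ h₂ h₃ hS := P.prop_of_iso e (hX P h₁ h₂ h₃ hS)

instance : (Coloc S).IsClosedUnderIsomorphisms where
  of_iso e hX P h₁ h₂ h₃ hS := P.prop_of_iso e (hX P h₁ h₂ h₃ hS)

instance : (Loc S).IsTriangulated where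
  exists_zero := ⟨_, isZero_zero T, fun P _ _ _ _ => P.prop_zero⟩
  isStableUnderShiftBy n := ⟨fun _ hX P h₁ h₂ h₃ hS => P.le_shift n _ (hX P h₁ h₂ h₃ hS)⟩
  toIsTriangulatedClosed₂ := .mk' fun T hT hX hY P h₁ h₂ h₃ hS =>
    P.ext_of_isTriangulatedClosed₂ T hT (hX P h₁ h₂ h₃ hS) (hY P h₁ h₂ h₃ hS)

instance : (Coloc S).IsTriangulated where
  exists_zero := ⟨_, isZero_zero T, fun P _ _ _ _ => P.prop_zero⟩
  isStableUnderShiftBy n := ⟨fun _ hX P h₁ h₂ h₃ hS => P.le_shift n _ (hX P h₁ h₂ h₃ hS)⟩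
  toIsTriangulatedClosed₂ := .mk' fun T hT hX hY P h₁ h₂ h₃ hS =>
    P.ext_of_isTriangulatedClosed₂ T hT (hX P h₁ h₂ h₃ hS) (hY P h₁ h₂ h₃ hS)

instance (J : Type v) : (Loc S).IsClosedUnderColimitsOfShape (Discrete J) where
  colimitsOfShape_le X hX P h₁ h₂ h₃ hS := by
    obtain ⟨hX⟩ := hX
    have := h₃ J
    exact P.prop_of_isColimit hX.isColimit fun j => hX.prop_diag_obj j P h₁ h₂ h₃ hS

instance (J : Type v) : (Coloc S).IsClosedUnderLimitsOfShape (Discrete J) where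
  limitsOfShape_le X hX P h₁ h₂ h₃ hS := by
    obtain ⟨hX⟩ := hX
    have := h₃ J
    exact P.prop_of_isLimit hX.isLimit fun j => hX.prop_diag_obj j P h₁ h₂ h₃ hS

variable {S}

/-- A left orthogonal is itself triangulated and closed under coproducts, so minimality of `Loc S`
applies. -/
lemma loc_le_leftOrthogonal (V : ObjectProperty T) [V.IsStableUnderShift ℤ]
    (h : S ≤ V.leftOrthogonal) : Loc S ≤ V.leftOrthogonal := by
  intro X hX
  refine hX _ inferInstance inferInstance (fun J => ⟨?_⟩) h
  rintro X ⟨hX⟩ Y f hY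
  exact hX.isColimit.hom_ext fun j => by rw [comp_zero]; exact hX.prop_diag_obj j _ hY

lemma coloc_le_rightOrthogonal (V : ObjectProperty T) [V.IsStableUnderShift ℤ]
    (h : S ≤ V.rightOrthogonal) : Coloc S ≤ V.rightOrthogonal := by
  intro X hX
  refine hX _ inferInstance inferInstance (fun J => ⟨?_⟩) h
  rintro X ⟨hX⟩ Y f hY
  exact hX.isLimit.hom_ext fun j => by rw [zero_comp]; exact hX.prop_diag_obj j _ hY

end Localizing

end Triangulated

/-! ### Products and coproducts in the homotopy category. -/

section HomotopyProducts

variable {V : Type*} [Category* V] [Preadditive V] {ι : Type*} (c : ComplexShape ι) {J : Type*}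

noncomputable def homotopyOfSigma [HasCoproductsOfShape J V] {Y : J → HomologicalComplex V c}
    {Z : HomologicalComplex V c} (f g : ∐ Y ⟶ Z)
    (h : ∀ j, Homotopy (Sigma.ι Y j ≫ f) (Sigma.ι Y j ≫ g)) : Homotopy f g :=
  let hc (p : ι) : IsColimit (Cofan.mk ((∐ Y).X p) (fun j => (Sigma.ι Y j).f p)) :=
    isColimitOfHasCoproductOfPreservesColimit (HomologicalComplex.eval V c p) Y
  let H : ∀ p q, (∐ Y).X p ⟶ Z.X q := fun p q => Cofan.IsColimit.desc (hc p) fun j => (h j).hom p q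
  have hH : ∀ j p q, (Sigma.ι Y j).f p ≫ H p q = (h j).hom p q := fun j p q =>
    Cofan.IsColimit.fac (hc p) _ j
  { hom := H
    zero := fun p q hpq => Cofan.IsColimit.hom_ext (hc p) _ _ fun j => by
      change (Sigma.ι Y j).f p ≫ H p q = (Sigma.ι Y j).f p ≫ 0
      rw [hH, comp_zero, (h j).zero p q hpq]
    comm := fun p => Cofan.IsColimit.hom_ext (hc p) _ _ fun j => by
      change (Sigma.ι Y j).f p ≫ _ = (Sigma.ι Y j).f p ≫ _
      have := (h j).comm p
      simp only [HomologicalComplex.comp_f] at this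
      rw [this, Preadditive.comp_add, Preadditive.comp_add, ← dNext_comp_left, ← prevD_comp_left]
      simp only [hH] }

noncomputable def homotopyOfPi [HasProductsOfShape J V] {Y : J → HomologicalComplex V c}
    {Z : HomologicalComplex V c} (f g : Z ⟶ ∏ᶜ Y)
    (h : ∀ j, Homotopy (f ≫ Pi.π Y j) (g ≫ Pi.π Y j)) : Homotopy f g :=
  let hc (p : ι) : IsLimit (Fan.mk ((∏ᶜ Y).X p) (fun j => (Pi.π Y j).f p)) :=
    isLimitOfHasProductOfPreservesLimit (HomologicalComplex.eval V c p) Y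
  let H : ∀ p q, Z.X p ⟶ (∏ᶜ Y).X q := fun p q => Fan.IsLimit.lift (hc q) fun j => (h j).hom p q
  have hH : ∀ j p q, H p q ≫ (Pi.π Y j).f q = (h j).hom p q := fun j p q =>
    Fan.IsLimit.fac (hc q) _ j
  { hom := H
    zero := fun p q hpq => Fan.IsLimit.hom_ext (hc q) _ _ fun j => by
      change H p q ≫ (Pi.π Y j).f q = 0 ≫ (Pi.π Y j).f q
      rw [hH, zero_comp, (h j).zero p q hpq]
    comm := fun p => Fan.IsLimit.hom_ext (hc p) _ _ fun j => by
      change _ ≫ (Pi.π Y j).f p = _ ≫ (Pi.π Y j).f p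
      have := (h j).comm p
      simp only [HomologicalComplex.comp_f] at this
      rw [this, Preadditive.add_comp, Preadditive.add_comp, ← dNext_comp_right, ← prevD_comp_right]
      simp only [hH] }

/-- Existence of the induced map comes from choosing chain representatives of the components.
Uniqueness holds because homotopies on the summands assemble to one on the coproduct. -/
noncomputable def isColimitQuotientCofan [HasCoproductsOfShape J V]
    (Y : J → HomologicalComplex V c) :
    IsColimit (Cofan.mk (f := fun j => (HomotopyCategory.quotient V c).obj (Y j))
      ((HomotopyCategory.quotient V c).obj (∐ Y))
      (fun j => (HomotopyCategory.quotient V c).map (Sigma.ι Y j))) :=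
  Cofan.IsColimit.mk _
    (fun s => (HomotopyCategory.quotient V c).map
      (Sigma.desc fun j => ((HomotopyCategory.quotient V c).map_surjective (s.inj j)).choose))
    (fun s j => by
      change (HomotopyCategory.quotient V c).map _ ≫ (HomotopyCategory.quotient V c).map _ = _
      rw [← Functor.map_comp, Sigma.ι_desc]
      exact ((HomotopyCategory.quotient V c).map_surjective (s.inj j)).choose_spec)
    (fun s m hm => by
      obtain ⟨m, rfl⟩ := (HomotopyCategory.quotient V c).map_surjective m
      refine HomotopyCategory.eq_of_homotopy _ _ (homotopyOfSigma c _ _ fun j =>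
        HomotopyCategory.homotopyOfEq _ _ ?_)
      rw [Sigma.ι_desc, ((HomotopyCategory.quotient V c).map_surjective (s.inj j)).choose_spec,
        ← hm j, Functor.map_comp]
      rfl)

noncomputable def isLimitQuotientFan [HasProductsOfShape J V]
    (Y : J → HomologicalComplex V c) :
    IsLimit (Fan.mk (f := fun j => (HomotopyCategory.quotient V c).obj (Y j))
      ((HomotopyCategory.quotient V c).obj (∏ᶜ Y))
      (fun j => (HomotopyCategory.quotient V c).map (Pi.π Y j))) :=
  Fan.IsLimit.mk _
    (fun s => (HomotopyCategory.quotient V c).map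
      (Pi.lift fun j => ((HomotopyCategory.quotient V c).map_surjective (s.proj j)).choose))
    (fun s j => by
      change (HomotopyCategory.quotient V c).map _ ≫ (HomotopyCategory.quotient V c).map _ = _
      rw [← Functor.map_comp, Pi.lift_π]
      exact ((HomotopyCategory.quotient V c).map_surjective (s.proj j)).choose_spec)
    (fun s m hm => by
      obtain ⟨m, rfl⟩ := (HomotopyCategory.quotient V c).map_surjective m
      refine HomotopyCategory.eq_of_homotopy _ _ (homotopyOfPi c _ _ fun j =>
        HomotopyCategory.homotopyOfEq _ _ ?_)
      rw [Pi.lift_π, ((HomotopyCategory.quotient V c).map_surjective (s.proj j)).choose_spec,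
        ← hm j, Functor.map_comp]
      rfl)

instance [HasCoproductsOfShape J V] : HasCoproductsOfShape J (HomotopyCategory V c) :=
  have (X : J → HomotopyCategory V c) : HasCoproduct X :=
    ⟨⟨⟨_, isColimitQuotientCofan c fun j => (X j).as⟩⟩⟩
  ⟨fun _ => hasColimit_of_iso Discrete.natIsoFunctor⟩

instance [HasProductsOfShape J V] : HasProductsOfShape J (HomotopyCategory V c) :=
  have (X : J → HomotopyCategory V c) : HasProduct X :=
    ⟨⟨⟨_, isLimitQuotientFan c fun j => (X j).as⟩⟩⟩
  ⟨fun _ => hasLimit_of_iso Discrete.natIsoFunctor.symm⟩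

end HomotopyProducts

/-! ### Pure acyclicity as orthogonality to a set of compact stalks. -/

section Stalks

variable {R : Type u} [Ring R]

/-- A module, placed in degree `p`, as an object of the homotopy category. -/
noncomputable abbrev stalkAt (M : ModuleCat.{u} R) (p : ℤ) : K R :=
  (HomotopyCategory.quotient _ _).obj ((CochainComplex.singleFunctor (ModuleCat.{u} R) p).obj M)

lemma nonempty_stalkAt_shift_iso (M : ModuleCat.{u} R) (n p q : ℤ) (h : n + p = q) :
    Nonempty ((stalkAt M q)⟦n⟧ ≅ stalkAt M p) :=
  ⟨((HomotopyCategory.singleFunctors (ModuleCat.{u} R)).shiftIso n p q h).app M⟩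

open CochainComplex.HomComplex in
/-- The map out of a module placed in degree `j` attached to a cocycle. -/
noncomputable def stalkHom {M : ModuleCat.{u} R} {X : Cplx R} {j : ℤ} (f : M ⟶ X.X j) {k : ℤ}
    (hjk : j + 1 = k) (hf : f ≫ X.d j k = 0) :
    stalkAt M j ⟶ (HomotopyCategory.quotient _ _).obj X :=
  (HomotopyCategory.quotient _ _).map
    (Cocycle.homOf (Cocycle.fromSingleMk f (add_zero j) k hjk hf))

-- Together with `exists_eq_stalkHom` this identifies maps from a stalk in degree `j` with classes
-- in `H^j Hom(M, X)`.
open CochainComplex.HomComplex in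
lemma stalkHom_eq_zero_iff {M : ModuleCat.{u} R} {X : Cplx R} {i j k : ℤ} (f : M ⟶ X.X j)
    (hij : i + 1 = j) (hjk : j + 1 = k) (hf : f ≫ X.d j k = 0) :
    stalkHom f hjk hf = 0 ↔ ∃ g : M ⟶ X.X i, g ≫ X.d i j = f := by
  rw [stalkHom, ← Cocycle.fromSingleMk_mem_coboundaries_iff f (add_zero j) k hjk hf i hij,
    mem_coboundaries_iff _ (-1) (by simp), HomotopyCategory.quotient_map_eq_zero_iff,
    (Cochain.equivHomotopy _ _).nonempty_congr]
  simp [eq_comm]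

open CochainComplex.HomComplex in
lemma exists_eq_stalkHom {M : ModuleCat.{u} R} {X : Cplx R} {j k : ℤ} (hjk : j + 1 = k)
    (φ : stalkAt M j ⟶ (HomotopyCategory.quotient _ _).obj X) :
    ∃ (f : M ⟶ X.X j) (hf : f ≫ X.d j k = 0), φ = stalkHom f hjk hf := by
  obtain ⟨φ, rfl⟩ := (HomotopyCategory.quotient _ _).map_surjective φ
  obtain ⟨g, hg, hgf⟩ := Cocycle.fromSingleMk_surjective (Cocycle.ofHom φ) j (add_zero j) k hjk
  refine ⟨g, hg, ?_⟩
  rw [stalkHom, hgf, Cocycle.homOf_ofHom_eq_self]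

open CochainComplex.HomComplex in
lemma stalkHom_comp {M : ModuleCat.{u} R} {X Y : Cplx R} {j k : ℤ} (f : M ⟶ X.X j)
    (hjk : j + 1 = k) (hf : f ≫ X.d j k = 0) (g : X ⟶ Y) :
    stalkHom f hjk hf ≫ (HomotopyCategory.quotient _ _).map g =
      stalkHom (f ≫ g.f j) hjk (by rw [Category.assoc, g.comm, reassoc_of% hf, zero_comp]) := by
  rw [stalkHom, stalkHom, ← Functor.map_comp]
  congr 1
  have h (z : Cocycle ((CochainComplex.singleFunctor (ModuleCat.{u} R) j).obj M) X 0) :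
      Cocycle.homOf z ≫ g = Cocycle.homOf (z.postcomp g) := by
    ext n
    simp [Cocycle.homOf, Cocycle.postcomp]
  rw [h, Cocycle.fromSingleMk_postcomp]

lemma forall_stalkAt_eq_zero_iff (M : ModuleCat.{u} R) (X : Cplx R) (i j k : ℤ) (hij : i + 1 = j)
    (hjk : j + 1 = k) :
    (∀ f : stalkAt M j ⟶ (HomotopyCategory.quotient _ _).obj X, f = 0) ↔
      ∀ f : M ⟶ X.X j, f ≫ X.d j k = 0 → ∃ g : M ⟶ X.X i, g ≫ X.d i j = f := by
  constructor
  · intro h f hf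
    exact (stalkHom_eq_zero_iff f hij hjk hf).1 (h _)
  · intro h f
    obtain ⟨g, hg, rfl⟩ := exists_eq_stalkHom hjk f
    rw [stalkHom_eq_zero_iff g hij hjk hg]
    exact h g hg

lemma pureAcyclic_iff_exists (X : Cplx R) : PureAcyclic X ↔
    ∀ M : ModuleCat.{u} R, Module.FinitePresentation R M →
      ∀ (i j k : ℤ) (_ : i + 1 = j) (_ : j + 1 = k) (f : M ⟶ X.X j), f ≫ X.d j k = 0 →
        ∃ g : M ⟶ X.X i, g ≫ X.d i j = f := by
  refine forall_congr' fun M => forall_congr' fun _ => ⟨fun h i j k hij hjk => ?_, fun h j => ?_⟩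
  · have := h j
    rw [HomologicalComplex.exactAt_iff' _ i j k (by simp [← hij]) (by simp [hjk]),
      ShortComplex.ab_exact_iff] at this
    exact this
  · rw [HomologicalComplex.exactAt_iff' _ (j - 1) j (j + 1) (by simp) (by simp),
      ShortComplex.ab_exact_iff]
    exact h _ _ _ (by simp) rfl

lemma pureAcyclic_iff (X : Cplx R) : PureAcyclic X ↔
    ∀ M : ModuleCat.{u} R, Module.FinitePresentation R M → ∀ (p : ℤ)
      (f : stalkAt M p ⟶ (HomotopyCategory.quotient _ _).obj X), f = 0 := by
  rw [pureAcyclic_iff_exists]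
  refine forall_congr' fun M => forall_congr' fun _ => ⟨fun h p => ?_, fun h i j k hij hjk => ?_⟩
  · rw [forall_stalkAt_eq_zero_iff M X (p - 1) p (p + 1) (by simp) rfl]
    exact h _ _ _ (by simp) rfl
  · exact (forall_stalkAt_eq_zero_iff M X i j k hij hjk).1 (h j)

/-- An index set for the finitely presented modules, up to isomorphism. -/
abbrev FinPresIndex (R : Type u) [Ring R] : Type u :=
  Σ n : ℕ, { N : Submodule R (Fin n → R) // N.FG }

/-- The finitely presented module attached to an index. -/
noncomputable abbrev FinPresIndex.module (a : FinPresIndex R) : ModuleCat.{u} R :=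
  ModuleCat.of R ((Fin a.1 → R) ⧸ a.2.1)

lemma FinPresIndex.finitePresentation (a : FinPresIndex R) :
    Module.FinitePresentation R a.module :=
  Module.finitePresentation_of_surjective a.2.1.mkQ a.2.1.mkQ_surjective (by simpa using a.2.2)

lemma FinPresIndex.exists_iso (M : ModuleCat.{u} R) (hM : Module.FinitePresentation R M) :
    ∃ a : FinPresIndex R, Nonempty (M ≅ a.module) := by
  obtain ⟨n, N, e, hN⟩ := Module.FinitePresentation.exists_fin R M
  exact ⟨⟨n, N, hN⟩, ⟨e.toModuleIso⟩⟩

/-- The finitely presented modules placed in all degrees. -/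
noncomputable def finPresStalk (a : FinPresIndex R × ℤ) : K R := stalkAt a.1.module a.2

lemma kpac_iff (X : K R) : Kpac R X ↔ ∀ (a : FinPresIndex R × ℤ) (f : finPresStalk a ⟶ X), f = 0 := by
  refine (pureAcyclic_iff X.as).trans ⟨fun h a f => h _ a.1.finitePresentation _ f,
    fun h M hM p f => ?_⟩
  obtain ⟨a, ⟨e⟩⟩ := FinPresIndex.exists_iso M hM
  let e' : finPresStalk (a, p) ≅ stalkAt M p :=
    (CochainComplex.singleFunctor (ModuleCat.{u} R) p ⋙ HomotopyCategory.quotient _ _).mapIso e.symm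
  rw [← cancel_epi e'.hom, comp_zero]
  exact h (a, p) _

lemma exists_finPresStalk_iso_shift (a : FinPresIndex R × ℤ) :
    ∃ b, Nonempty (finPresStalk a ≅ (finPresStalk b)⟦(1 : ℤ)⟧) := by
  obtain ⟨e⟩ := nonempty_stalkAt_shift_iso a.1.module 1 a.2 (1 + a.2) rfl
  exact ⟨(a.1, 1 + a.2), ⟨e.symm⟩⟩

/-- As the right orthogonal of a shift-stable class, `Kpac R` inherits its triangulated structure.
-/
lemma kpac_eq_rightOrthogonal :
    Kpac R = (ObjectProperty.ofObj (finPresStalk (R := R))).isoClosure.rightOrthogonal := by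
  ext X
  rw [kpac_iff]
  constructor
  · rintro h Y f ⟨_, ⟨a⟩, ⟨e⟩⟩
    rw [← cancel_epi e.inv, comp_zero]
    exact h a _
  · intro h a f
    exact h f (ObjectProperty.le_isoClosure _ _ ⟨a⟩)

instance : (ObjectProperty.ofObj (finPresStalk (R := R))).isoClosure.IsStableUnderShift ℤ where
  isStableUnderShiftBy n := ⟨by
    rintro X ⟨_, ⟨a⟩, ⟨e⟩⟩
    obtain ⟨e'⟩ := nonempty_stalkAt_shift_iso a.1.module n (a.2 - n) a.2 (by simp)
    exact ⟨_, ⟨(a.1, a.2 - n)⟩, ⟨(shiftFunctor _ n).mapIso e ≪≫ e'⟩⟩⟩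

instance : (Kpac R).IsClosedUnderIsomorphisms := by
  rw [kpac_eq_rightOrthogonal]
  infer_instance

instance : (Kpac R).IsTriangulated := by
  rw [kpac_eq_rightOrthogonal]
  infer_instance

lemma loc_finPres_finPresStalk (a : FinPresIndex R × ℤ) : Loc (finPres R) (finPresStalk a) := by
  obtain ⟨e⟩ := nonempty_stalkAt_shift_iso a.1.module (-a.2) a.2 0 (by simp)
  exact (Loc (finPres R)).prop_of_iso e ((Loc (finPres R)).le_shift (-a.2) _
    (le_loc _ _ ⟨_, a.1.finitePresentation, ⟨Iso.refl _⟩⟩))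

lemma finPres_le_leftOrthogonal_kpac : finPres R ≤ (Kpac R).leftOrthogonal := by
  rintro X ⟨M, hM, ⟨e⟩⟩ Y f hY
  rw [← cancel_epi e.inv, comp_zero]
  exact (pureAcyclic_iff Y.as).1 hY M hM 0 _

/-- The elements with finite support form a submodule containing every summand, so its quotient map
vanishes by the universal property of the coproduct. Demanding the identity for all `t ⊇ s` lets
supports be enlarged to a common one. -/
lemma exists_finset_sum_π_ι_apply {J : Type} [DecidableEq J] (Y : J → Cplx R) (p : ℤ)
    (y : ((∐ Y : Cplx R).X p : ModuleCat.{u} R)) :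
    ∃ s : Finset J, ∀ t, s ⊆ t →
      ∑ n ∈ t, (Sigma.ι Y n).f p ((Sigma.π Y n).f p y) = y := by
  let N : Submodule R ((∐ Y : Cplx R).X p) :=
    { carrier := {y | ∃ s : Finset J, ∀ t, s ⊆ t →
        ∑ n ∈ t, (Sigma.ι Y n).f p ((Sigma.π Y n).f p y) = y}
      add_mem' := by
        rintro a b ⟨s, hs⟩ ⟨s', hs'⟩
        refine ⟨s ∪ s', fun t ht => ?_⟩
        simp only [map_add, Finset.sum_add_distrib]
        rw [hs t (Finset.union_subset_left ht), hs' t (Finset.union_subset_right ht)]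
      zero_mem' := ⟨∅, fun t _ => by simp⟩
      smul_mem' := by
        rintro r a ⟨s, hs⟩
        refine ⟨s, fun t ht => ?_⟩
        simp only [map_smul, ← Finset.smul_sum]
        rw [hs t ht] }
  have hι (j : J) (x : (Y j).X p) : (Sigma.ι Y j).f p x ∈ N := by
    refine ⟨{j}, fun t ht => ?_⟩
    have h₁ (n : J) : (Sigma.π Y n).f p ((Sigma.ι Y j).f p x) =
        (Sigma.ι Y j ≫ Sigma.π Y n).f p x := rfl
    rw [Finset.sum_eq_single j]
    · rw [h₁, Sigma.ι_π_eq_id]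
      rfl
    · intro n _ hn
      rw [h₁, Sigma.ι_π_of_ne _ hn.symm]
      exact map_zero _
    · intro hj
      exact (hj (ht (by simp))).elim
  have hc : IsColimit (Cofan.mk ((∐ Y : Cplx R).X p) (fun j => (Sigma.ι Y j).f p)) :=
    isColimitOfHasCoproductOfPreservesColimit
      (HomologicalComplex.eval (ModuleCat.{u} R) (ComplexShape.up ℤ) p) Y
  have hq : ModuleCat.ofHom N.mkQ = 0 := Cofan.IsColimit.hom_ext hc _ _ fun j => by
    ext x
    exact (Submodule.Quotient.mk_eq_zero N).2 (hι j x)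
  exact (Submodule.Quotient.mk_eq_zero N).1 (ConcreteCategory.congr_hom hq y)

lemma exists_finset_sum_π_ι {J : Type} [DecidableEq J] (Y : J → Cplx R) (M : ModuleCat.{u} R) [Module.Finite R M] (p : ℤ)
    (f : (HomologicalComplex.single (ModuleCat.{u} R) (ComplexShape.up ℤ) p).obj M ⟶ ∐ Y) :
    ∃ s : Finset J, f = ∑ n ∈ s, (f ≫ Sigma.π Y n) ≫ Sigma.ι Y n := by
  obtain ⟨S, hS⟩ := Module.Finite.fg_top (R := R) (M := M)
  let e : M ⟶ ((HomologicalComplex.single (ModuleCat.{u} R) (ComplexShape.up ℤ) p).obj M).X p :=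
    (HomologicalComplex.singleObjXSelf (ComplexShape.up ℤ) p M).inv
  choose s hs using exists_finset_sum_π_ι_apply Y p
  -- A map out of a finitely generated module is supported on the union of the supports of the
  -- images of the generators.
  refine ⟨S.biUnion fun x => s (f.f p (e x)), HomologicalComplex.from_single_hom_ext ?_⟩
  rw [← cancel_epi (HomologicalComplex.singleObjXSelf (ComplexShape.up ℤ) p M).inv]
  refine ModuleCat.hom_ext (LinearMap.ext_on hS fun x hx => ?_)
  have h := hs (f.f p (e x)) (S.biUnion fun x => s (f.f p (e x)))
    (Finset.subset_biUnion_of_mem (fun x => s (f.f p (e x))) hx)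
  refine h.symm.trans ?_
  have h₂ : (∑ n ∈ S.biUnion fun x => s (f.f p (e x)), (f ≫ Sigma.π Y n) ≫ Sigma.ι Y n).f p =
      ∑ n ∈ S.biUnion fun x => s (f.f p (e x)), ((f ≫ Sigma.π Y n) ≫ Sigma.ι Y n).f p :=
    map_sum (HomologicalComplex.Hom.fAddMonoidHom p) _ _
  rw [h₂, ModuleCat.hom_comp, ModuleCat.hom_sum, LinearMap.comp_apply, LinearMap.sum_apply]
  rfl

lemma finPresStalk_compact (X : ℕ → K R) (a : FinPresIndex R × ℤ) (f : finPresStalk a ⟶ ∐ X) :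
    ∃ (s : Finset ℕ) (g : ∀ n, finPresStalk a ⟶ X n), f = ∑ n ∈ s, g n ≫ Sigma.ι X n := by
  let Y : ℕ → Cplx R := fun n => (X n).as
  let e : ∐ X ≅ (HomotopyCategory.quotient _ _).obj (∐ Y) :=
    (coproductIsCoproduct X).coconePointUniqueUpToIso
    (isColimitQuotientCofan (ComplexShape.up ℤ) Y)
  have he (n : ℕ) : (HomotopyCategory.quotient _ _).map (Sigma.ι Y n) ≫ e.inv = Sigma.ι X n :=
    (coproductIsCoproduct X).comp_coconePointUniqueUpToIso_inv
      (isColimitQuotientCofan (ComplexShape.up ℤ) Y) ⟨n⟩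
  obtain ⟨f', hf'⟩ := (HomotopyCategory.quotient _ _).map_surjective (f ≫ e.hom)
  have := a.1.finitePresentation
  obtain ⟨s, hs⟩ : ∃ s : Finset ℕ, f' = ∑ n ∈ s, (f' ≫ Sigma.π Y n) ≫ Sigma.ι Y n :=
    exists_finset_sum_π_ι Y a.1.module a.2 f'
  refine ⟨s, fun n => (HomotopyCategory.quotient _ _).map (f' ≫ Sigma.π Y n), ?_⟩
  have : f = (HomotopyCategory.quotient _ _).map f' ≫ e.inv :=
    (Iso.eq_comp_inv e).2 hf'.symm
  rw [this]
  conv_lhs => rw [hs]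
  rw [Functor.map_sum, Preadditive.sum_comp]
  refine Finset.sum_congr rfl fun n _ => ?_
  rw [Functor.map_comp, Category.assoc, he]
  rfl

theorem isStableTStructure_loc : IsStableTStructure (Loc (finPres R)) (Kpac R) where
  left_isoClosed := inferInstance
  right_isoClosed := inferInstance
  left_triangulated := inferInstance
  right_triangulated := inferInstance
  hom_eq_zero _ _ hA hB f :=
    loc_le_leftOrthogonal (Kpac R) finPres_le_leftOrthogonal_kpac _ hA f hB
  exists_triangle X := by
    obtain ⟨A, B, f, g, h, hA, hB, hT⟩ := exists_triangle_of_compact (Loc (finPres R))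
      (fun J => inferInstance) finPresStalk loc_finPres_finPresStalk exists_finPresStalk_iso_shift
      finPresStalk_compact X
    exact ⟨A, B, f, g, h, hA, (kpac_iff B).2 hB, hT⟩

end Stalks

/-! ### The duality `Hom_R(Y, ν P) ≅ Hom_k(Hom_R(P, Y), I)`. -/

section Duality

variable {k : Type w} [CommRing k] {R : Type u} [Ring R] [Algebra k R] {I : ModuleCat.{u} k}

lemma exists_extension_of_injective (hI : Injective I) {A B : Type u} [AddCommGroup A] [Module k A]
    [AddCommGroup B] [Module k B] (a : A →ₗ[k] B) (l : A →ₗ[k] I) (h : ∀ x, a x = 0 → l x = 0) :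
    ∃ m : B →ₗ[k] I, ∀ x, m (a x) = l x := by
  let i : ModuleCat.of k (A ⧸ LinearMap.ker a) ⟶ ModuleCat.of k B :=
    ModuleCat.ofHom ((LinearMap.ker a).liftQ a le_rfl)
  let q : ModuleCat.of k (A ⧸ LinearMap.ker a) ⟶ I :=
    ModuleCat.ofHom ((LinearMap.ker a).liftQ l fun x hx => h x hx)
  have : Mono i := (ModuleCat.mono_iff_injective i).2
    (LinearMap.ker_eq_bot.1 ((LinearMap.ker a).ker_liftQ_eq_bot _ _ le_rfl))
  refine ⟨(Injective.factorThru q i).hom, fun x => ?_⟩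
  exact ConcreteCategory.congr_hom (Injective.comp_factorThru q i)
    (Submodule.Quotient.mk x : A ⧸ LinearMap.ker a)

lemma exists_functional_of_isCoseparator (hI : IsCoseparator I) {A : Type u} [AddCommGroup A]
    [Module k A] (S : Submodule k A) (x : A) (hx : x ∉ S) :
    ∃ l : A →ₗ[k] I, (∀ y ∈ S, l y = 0) ∧ l x ≠ 0 := by
  by_contra! h
  have : S.mkQ x = 0 := by
    -- The cyclic submodule stands in for `k` as test object, since `k` may live in a different
    -- universe from the modules.
    have h₁ : ModuleCat.ofHom (Submodule.span k {S.mkQ x}).subtype = 0 := by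
      refine (isCoseparator_def I).1 hI _ _ fun l => ?_
      rw [zero_comp]
      refine ModuleCat.hom_ext (LinearMap.ext fun ⟨y, hy⟩ => ?_)
      obtain ⟨c, rfl⟩ := Submodule.mem_span_singleton.1 hy
      have h₂ := h (l.hom.comp S.mkQ) fun y hy =>
        (congrArg l.hom ((Submodule.Quotient.mk_eq_zero S).2 hy)).trans (map_zero _)
      refine (l.hom.map_smul c (S.mkQ x)).trans ?_
      rw [show l.hom (S.mkQ x) = 0 from h₂, smul_zero]
      rfl
    exact ConcreteCategory.congr_hom h₁ ⟨S.mkQ x, Submodule.mem_span_singleton_self _⟩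
  exact hx ((Submodule.Quotient.mk_eq_zero S).1 this)

/-- The action of the base ring on a module over an algebra. -/
@[reducible]
def baseModule (k : Type w) [CommRing k] [Algebra k R] (Y : ModuleCat.{u} R) : Module k Y :=
  Module.restrictScalars k R Y

attribute [local instance] baseModule

lemma baseModule_isScalarTower (Y : ModuleCat.{u} R) : IsScalarTower k R Y :=
  IsScalarTower.restrictScalars k R Y

attribute [local instance] baseModule_isScalarTower

/-- The functionals on `Hom_R(P, Y)`. -/
abbrev HomDual (I : ModuleCat.{u} k) (P Y : ModuleCat.{u} R) := (P →ₗ[R] Y) →ₗ[k] I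

/-- Postcomposition with a linear map, as a `k`-linear map. -/
def postcompₗ (k : Type w) [CommRing k] [Algebra k R] (P : ModuleCat.{u} R) {Y Z : ModuleCat.{u} R}
    (g : Y ⟶ Z) : (P →ₗ[R] Y) →ₗ[k] (P →ₗ[R] Z) where
  toFun h := g.hom.comp h
  map_add' _ _ := LinearMap.comp_add _ _ _
  map_smul' c h := by
    ext x
    exact LinearMap.map_smul_of_tower g.hom c (h x)

/-- Precomposition with a linear map, as a `k`-linear map. -/
def precompₗ (k : Type w) [CommRing k] [Algebra k R] {P Q : ModuleCat.{u} R} (p : P ⟶ Q)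
    (Y : ModuleCat.{u} R) : (Q →ₗ[R] Y) →ₗ[k] (P →ₗ[R] Y) where
  toFun h := h.comp p.hom
  map_add' _ _ := rfl
  map_smul' _ _ := rfl

/-- The map `Y ⟶ ν P` attached to a functional on `Hom_R(P, Y)`. -/
def toNu {P Y : ModuleCat.{u} R} (l : HomDual I P Y) : Y ⟶ (nu R I).obj P :=
  ModuleCat.ofHom
    { toFun := fun y => show NuCarrier I P from
        { toFun := fun φ => l (φ.smulRight y)
          map_add' := fun φ ψ => by
            rw [← map_add]
            congr 1
            ext x
            exact add_smul _ _ _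
          map_smul' := fun c φ => by
            rw [RingHom.id_apply, ← map_smul]
            congr 1
            ext x
            exact smul_assoc c (φ x) y }
      map_add' := fun y z => LinearMap.ext fun φ => by
        refine Eq.trans (congrArg l ?_) (map_add l _ _)
        ext x
        exact smul_add _ _ _
      map_smul' := fun r y => LinearMap.ext fun φ => by
        refine congrArg l ?_
        ext x
        exact (mul_smul (φ x) r y).symm }

lemma toNu_apply {P Y : ModuleCat.{u} R} (l : HomDual I P Y) (y : Y) (φ : P →ₗ[R] R) :
    (show (P →ₗ[R] R) →ₗ[k] I from (toNu l).hom y) φ = l (φ.smulRight y) := rfl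

lemma comp_toNu {P Y Z : ModuleCat.{u} R} (g : Y ⟶ Z) (l : HomDual I P Z) :
    g ≫ toNu l = toNu (l.comp (postcompₗ k P g)) := by
  ext y
  refine LinearMap.ext fun φ => congrArg l ?_
  ext x
  exact (g.hom.map_smul (φ x) y).symm

lemma toNu_comp_map {P Q Y : ModuleCat.{u} R} (p : P ⟶ Q) (l : HomDual I P Y) :
    toNu l ≫ (nu R I).map p = toNu (l.comp (precompₗ k p Y)) := rfl

lemma exists_dual_basis (P : ModuleCat.{u} R) [Module.Finite R P] [Module.Projective R P] :
    ∃ (n : ℕ) (e : Fin n → P) (φ : Fin n → (P →ₗ[R] R)), ∀ x, ∑ a, φ a x • e a = x := by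
  obtain ⟨n, f, hf⟩ := Module.Finite.exists_fin' R P
  obtain ⟨s, hs⟩ := Module.projective_lifting_property f LinearMap.id hf
  refine ⟨n, fun a => f (Pi.single a 1), fun a => (LinearMap.proj a).comp s, fun x => ?_⟩
  have h := LinearMap.congr_fun hs x
  rw [LinearMap.comp_apply, LinearMap.id_apply, ← Finset.univ_sum_single (s x), map_sum] at h
  refine Eq.trans (Finset.sum_congr rfl fun a _ => ?_) h
  change s x a • f (Pi.single a 1) = f (Pi.single a (s x a))
  rw [← map_smul, ← Pi.single_smul, smul_eq_mul, mul_one]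

lemma toNu_injective {P Y : ModuleCat.{u} R} [Module.Finite R P] [Module.Projective R P] :
    Function.Injective (toNu : HomDual I P Y → _) := by
  intro l l' h
  obtain ⟨n, e, φ, he⟩ := exists_dual_basis P
  refine LinearMap.ext fun g => ?_
  have hg : g = ∑ a, (φ a).smulRight (g (e a)) := by
    ext x
    conv_lhs => rw [← he x]
    simp [LinearMap.sum_apply]
  rw [hg, map_sum, map_sum]
  refine Finset.sum_congr rfl fun a _ => ?_
  rw [← toNu_apply, ← toNu_apply, h]

lemma toNu_surjective {P Y : ModuleCat.{u} R} [Module.Finite R P] [Module.Projective R P] :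
    Function.Surjective (toNu : HomDual I P Y → _) := by
  intro f
  obtain ⟨n, e, φ, he⟩ := exists_dual_basis P
  let F (y : Y) : (P →ₗ[R] R) →ₗ[k] I := f.hom y
  have hadd (y z : Y) (ψ : P →ₗ[R] R) : F (y + z) ψ = F y ψ + F z ψ :=
    LinearMap.congr_fun (f.hom.map_add y z : F (y + z) = F y + F z) ψ
  have hsmul (r : R) (y : Y) (ψ : P →ₗ[R] R) : F (r • y) ψ = F y (dualRMul k P r ψ) :=
    LinearMap.congr_fun (f.hom.map_smul r y : F (r • y) = (F y).comp (dualRMul k P r)) ψ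
  -- Writing `h = ∑ a, (φ a).smulRight (h (e a))` forces this formula for a preimage of `f`.
  let l : HomDual I P Y :=
    { toFun := fun h => ∑ a, F (h (e a)) (φ a)
      map_add' := fun h h' => by
        simp only [LinearMap.add_apply, hadd, Finset.sum_add_distrib]
      map_smul' := fun (c : k) (h : P →ₗ[R] Y) => by
        rw [RingHom.id_apply, Finset.smul_sum]
        refine Finset.sum_congr rfl fun a _ => ?_
        have h₁ : (c • h) (e a) = algebraMap k R c • h (e a) := (algebraMap_smul R c (h (e a))).symm
        have h₂ : dualRMul k P (algebraMap k R c) (φ a) = c • φ a := by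
          ext x
          exact ((Algebra.commutes c (φ a x)).symm.trans (Algebra.smul_def c _).symm)
        rw [h₁, hsmul, h₂, map_smul] }
  refine ⟨l, ?_⟩
  ext y
  refine LinearMap.ext fun ψ => ?_
  have hψ : ψ = ∑ a, dualRMul k P (ψ (e a)) (φ a) := by
    ext x
    conv_lhs => rw [← he x]
    simp [LinearMap.sum_apply, dualRMul]
  have h₃ : F y ψ = ∑ a, F y (dualRMul k P (ψ (e a)) (φ a)) := by
    conv_lhs => rw [hψ, map_sum]
  change ∑ a, F (ψ (e a) • y) (φ a) = F y ψ
  rw [h₃]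
  exact Finset.sum_congr rfl fun a _ => hsmul _ _ _

end Duality

/-! ### Null-homotopies built by upward induction on the degree. -/

section HomotopyZero

open CochainComplex CochainComplex.HomComplex Preadditive

variable {C : Type*} [Category* C] [Preadditive C] {K L : CochainComplex C ℤ}

lemma exists_extend_homotopy (f : K ⟶ L) (α : Cochain K L (-1)) (n m : ℤ) (hnm : n + 1 = m)
    (hKL : ∀ u : K.X m ⟶ L.X m, K.d n m ≫ u = 0 →
      ∃ v : K.X (m + 1) ⟶ L.X m, K.d m (m + 1) ≫ v = u)
    (hα : (δ (-1) 0 α).EqUpTo (Cochain.ofHom f) n) :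
    ∃ h : K.X (n + 2) ⟶ L.X (n + 1),
      (δ (-1) 0 (α + Cochain.single h (-1))).EqUpTo (Cochain.ofHom f) m := by
  subst hnm
  obtain ⟨n₂, hn₂⟩ : ∃ n₂, n₂ = n + 1 + 1 := ⟨_, rfl⟩
  obtain rfl : n₂ = n + 2 := by lia
  rw [← hn₂] at hKL
  let u := f.f (n + 1) - α.v (n + 1) n (by lia) ≫ L.d n (n + 1) -
    K.d (n + 1) (n + 2) ≫ α.v (n + 2) (n + 1) (by lia)
  have hu : K.d n (n + 1) ≫ u = 0 := by
    have eq := hα n n (add_zero n) (by rfl)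
    simp only [δ_v (-1) 0 (neg_add_cancel 1) α n n (add_zero _) (n - 1) (n + 1)
      (by lia) (by lia), Int.negOnePow_zero, one_smul, Cochain.ofHom_v] at eq
    simp only [u, comp_sub, HomologicalComplex.d_comp_d_assoc, zero_comp,
      ← f.comm, ← eq, add_comp, Category.assoc, L.d_comp_d, comp_zero, zero_add, sub_self]
  obtain ⟨β, hβ⟩ : ∃ β : K.X (n + 2) ⟶ L.X (n + 1), K.d (n + 1) (n + 2) ≫ β = u := hKL u hu
  refine ⟨β, ?_⟩
  intro p q hpq hp
  obtain rfl : p = q := by lia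
  obtain hp | rfl := hp.lt_or_eq
  · rw [δ_add, Cochain.add_v, hα p p (by lia) (by lia), add_eq_left,
      δ_v (-1) 0 (neg_add_cancel 1) _ p p hpq (p - 1) (p + 1) rfl rfl,
      Cochain.single_v_eq_zero _ _ _ _ _ (by lia),
      Cochain.single_v_eq_zero _ _ _ _ _ (by lia)]
    simp
  · rw [δ_v (-1) 0 (neg_add_cancel 1) _ (n + 1) (n + 1) (by lia) n (n + 2)
      (by lia) (by lia), Cochain.add_v,
      Cochain.single_v_eq_zero _ _ _ _ _ (by lia)]
    simp [hβ, u]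

open Cochain.InductionUp in
lemma nonempty_homotopy_zero_of_extension (f : K ⟶ L) (d : ℤ) [L.IsStrictlyGE d]
    (hKL : ∀ n m : ℤ, n + 1 = m → ∀ u : K.X m ⟶ L.X m, K.d n m ≫ u = 0 →
      ∃ v : K.X (m + 1) ⟶ L.X m, K.d m (m + 1) ≫ v = u) :
    Nonempty (Homotopy f 0) := by
  let X (n : ℕ) : Set (Cochain K L (-1)) :=
    Set.ofPred (fun α => (δ (-1) 0 α).EqUpTo (Cochain.ofHom f) (n + d - 1))
  -- The induction can start from zero because `L` vanishes below degree `d`.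
  let x₀ : X 0 := ⟨0, fun p q hpq hp ↦
    IsZero.eq_of_tgt (L.isZero_of_isStrictlyGE d _ (by lia)) _ _⟩
  let φ (n : ℕ) (α : X n) : X (n + 1) :=
    ⟨_, (exists_extend_homotopy f α.1 (n + d - 1) ((n + 1 : ℕ) + d - 1)
      (by lia) (hKL _ _ (by lia)) α.2).choose_spec⟩
  have hφ (k : ℕ) (x : X k) : (φ k x).1.EqUpTo x.1 (d + k) := fun p q hpq hp => by
    dsimp [φ]
    rw [add_eq_left, Cochain.single_v_eq_zero _ _ _ _ _ (by lia)]
  refine ⟨(Cochain.equivHomotopy f 0).symm ⟨limitSequence φ hφ x₀, ?_⟩⟩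
  rw [Cochain.ofHom_zero, add_zero]
  ext n
  let k₀ := (n - d + 1).toNat
  rw [← (sequence φ x₀ k₀).2 n n (add_zero n) (by lia),
    δ_v (-1) 0 (neg_add_cancel 1) _ n n (by lia) (n - 1) (n + 1) rfl (by lia),
    δ_v (-1) 0 (neg_add_cancel 1) _ n n (by lia) (n - 1) (n + 1) rfl (by lia),
    limitSequence_eqUpTo φ hφ x₀ k₀ n (n - 1) (by lia) (by lia),
    limitSequence_eqUpTo φ hφ x₀ k₀ (n + 1) n (by lia) (by lia)]

end HomotopyZero

/-! ### Pure acyclic complexes and the kernel of `ν p`. -/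

section SerreOrthogonal

variable {k : Type w} [CommRing k] {R : Type u} [Ring R] [Algebra k R] {I : ModuleCat.{u} k}

attribute [local instance] baseModule baseModule_isScalarTower

/-- Maps into the kernel of `ν p` extend along the differential of a pure acyclic complex, where
`p` presents a finitely presented module. -/
lemma exists_extension_to_ker_nu (hI : Injective I) {X : Cplx R} (hX : PureAcyclic X)
    {P₁ P₀ M : ModuleCat.{u} R} (p : P₁ ⟶ P₀) (π : P₀ ⟶ M) (w : p ≫ π = 0)
    (hp : (ShortComplex.mk p π w).Exact) [Epi π] [Module.Finite R P₁] [Module.Projective R P₁]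
    [Module.Finite R P₀] [Module.Projective R P₀] (hM : Module.FinitePresentation R M)
    {i j : ℤ} (hij : i + 1 = j) (φ : X.X j ⟶ (nu R I).obj P₁)
    (hφ : φ ≫ (nu R I).map p = 0) (hd : X.d i j ≫ φ = 0) :
    ∃ ψ : X.X (j + 1) ⟶ (nu R I).obj P₁, ψ ≫ (nu R I).map p = 0 ∧ X.d j (j + 1) ≫ ψ = φ := by
  have hP₁ : Module.FinitePresentation R P₁ := Module.finitePresentation_of_projective R P₁
  have hP₀ : Module.FinitePresentation R P₀ := Module.finitePresentation_of_projective R P₀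
  rw [pureAcyclic_iff_exists] at hX
  obtain ⟨l, rfl⟩ := toNu_surjective φ
  have hlp (h : P₀ ⟶ X.X j) : l (p ≫ h).hom = 0 := by
    have h₁ : l.comp (precompₗ k p (X.X j)) = 0 := by
      apply toNu_injective
      rw [← toNu_comp_map, hφ]
      rfl
    exact LinearMap.congr_fun h₁ h.hom
  have hld (h : P₁ ⟶ X.X i) : l (h ≫ X.d i j).hom = 0 := by
    have h₁ : l.comp (postcompₗ k P₁ (X.d i j)) = 0 := by
      apply toNu_injective
      rw [← comp_toNu, hd]
      rfl
    exact LinearMap.congr_fun h₁ h.hom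
  -- This is the condition for `l` to extend to `Hom(P₁, X^{j+1})` while vanishing on `Hom(P₀,
  -- X^{j+1})`. The chase lifts successively through `M`, `P₀` and `P₁`, using acyclicity of `Hom(-,
  -- X)` for each, and writes `h` as a coboundary minus a map factoring through `p`.
  have hwd (h : P₁ ⟶ X.X j) (h' : P₀ ⟶ X.X (j + 1)) (e : h ≫ X.d j (j + 1) + p ≫ h' = 0) :
      l h.hom = 0 := by
    have e' : p ≫ h' = -(h ≫ X.d j (j + 1)) := (neg_eq_of_add_eq_zero_right e).symm
    have h₁ : p ≫ h' ≫ X.d (j + 1) (j + 1 + 1) = 0 := by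
      rw [reassoc_of% e']
      simp
    obtain ⟨m, hm⟩ : ∃ m : M ⟶ X.X (j + 1 + 1), π ≫ m = h' ≫ X.d (j + 1) (j + 1 + 1) :=
      ⟨hp.desc _ h₁, hp.g_desc _ h₁⟩
    obtain ⟨n, hn⟩ := hX M hM (j + 1) (j + 1 + 1) (j + 1 + 1 + 1) rfl rfl m (by
      rw [← cancel_epi π, reassoc_of% hm]
      simp)
    obtain ⟨t, ht⟩ := hX P₀ hP₀ j (j + 1) (j + 1 + 1) rfl rfl (h' - π ≫ n) (by
      rw [Preadditive.sub_comp, Category.assoc, hn, hm, sub_self])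
    obtain ⟨s, hs⟩ := hX P₁ hP₁ i j (j + 1) hij rfl (h + p ≫ t) (by
      rw [Preadditive.add_comp, Category.assoc, ht, Preadditive.comp_sub, reassoc_of% w, zero_comp,
        sub_zero, e])
    have h₂ : h = s ≫ X.d i j - p ≫ t := by rw [hs, add_sub_cancel_right]
    rw [h₂, ModuleCat.hom_sub, map_sub, hlp, hld, sub_zero]
  -- Extending the functional `(h, h') ↦ l h` along the map `(h, h') ↦ h ≫ d + p ≫ h'` imposes both
  -- requirements on `m` at once.
  obtain ⟨m, hm⟩ := exists_extension_of_injective hI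
    (A := (P₁ →ₗ[R] X.X j) × (P₀ →ₗ[R] X.X (j + 1)))
    ((postcompₗ k P₁ (X.d j (j + 1))).coprod (precompₗ k p (X.X (j + 1))))
    (l.comp (LinearMap.fst k _ _)) (fun x hx => by
      refine hwd (ModuleCat.ofHom x.1) (ModuleCat.ofHom x.2) (ModuleCat.hom_ext ?_)
      exact hx)
  refine ⟨toNu m, ?_, ?_⟩
  · rw [toNu_comp_map]
    have : m.comp (precompₗ k p (X.X (j + 1))) = 0 := LinearMap.ext fun h => by
      have := hm (0, h)
      rw [LinearMap.coprod_apply, map_zero, zero_add] at this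
      exact this.trans (map_zero l)
    rw [this]
    rfl
  · rw [comp_toNu]
    congr 1
    refine LinearMap.ext fun h => ?_
    have := hm (h, 0)
    rw [LinearMap.coprod_apply, map_zero, add_zero] at this
    exact this

end SerreOrthogonal

/-! ### Degreewise kernels and exactness. -/

section KernelEval

variable {R : Type u} [Ring R] {A B : Cplx R}

instance (f : A ⟶ B) [Mono f] (m : ℤ) : Mono (f.f m) :=
  inferInstanceAs (Mono ((HomologicalComplex.eval _ _ m).map f))

instance (f : A ⟶ B) [Epi f] (m : ℤ) : Epi (f.f m) :=
  inferInstanceAs (Epi ((HomologicalComplex.eval _ _ m).map f))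

lemma kernel_ι_f_comp (g : A ⟶ B) (m : ℤ) : (kernel.ι g).f m ≫ g.f m = 0 := by
  rw [← HomologicalComplex.comp_f, kernel.condition, HomologicalComplex.zero_f]

lemma exists_lift_kernel_f (g : A ⟶ B) (m : ℤ) {Y : ModuleCat.{u} R} (φ : Y ⟶ A.X m)
    (h : φ ≫ g.f m = 0) : ∃ l : Y ⟶ (kernel g).X m, l ≫ (kernel.ι g).f m = φ := by
  let c := KernelFork.mapIsLimit (KernelFork.ofι (kernel.ι g) (kernel.condition g))
    (kernelIsKernel g) (HomologicalComplex.eval _ _ m)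
  exact ⟨c.lift (KernelFork.ofι φ h), c.fac (KernelFork.ofι φ h) WalkingParallelPair.zero⟩

lemma exact_f {M : Cplx R} {f : A ⟶ B} {g : B ⟶ M} {w : f ≫ g = 0}
    (h : (ShortComplex.mk f g w).Exact) (m : ℤ) :
    (ShortComplex.mk (f.f m) (g.f m)
      (by rw [← HomologicalComplex.comp_f, w, HomologicalComplex.zero_f])).Exact :=
  h.map (HomologicalComplex.eval _ _ m)

lemma finitePresentation_stalk_X (M : ModuleCat.{u} R) (hM : Module.FinitePresentation R M)
    (m : ℤ) : Module.FinitePresentation R ((stalk R M).X m) := by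
  by_cases h : m = 0
  · subst h
    exact Module.FinitePresentation.of_equiv
      (HomologicalComplex.singleObjXSelf (ComplexShape.up ℤ) 0 M).toLinearEquiv.symm
  · have : Subsingleton ((stalk R M).X m) :=
      ModuleCat.subsingleton_of_isZero (HomologicalComplex.isZero_single_obj_X _ _ _ _ h)
    infer_instance

end KernelEval

/-! ### The objects `𝕊 M` are orthogonal to the pure acyclics. -/

section SerreOrthogonal

variable {k : Type w} [CommRing k] {R : Type u} [Ring R] [Algebra k R] {I : ModuleCat.{u} k}

lemma isStrictlyGE_kernel_nu {P Q : Cplx R} (p : P ⟶ Q) (a : ℤ) [P.IsStrictlyGE a] :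
    (kernel ((nuCplx R I).map p)).IsStrictlyGE a := by
  rw [CochainComplex.isStrictlyGE_iff]
  intro i hi
  rw [IsZero.iff_id_eq_zero, ← cancel_mono ((kernel.ι ((nuCplx R I).map p)).f i)]
  exact ((nu R I).map_isZero (P.isZero_of_isStrictlyGE a i hi)).eq_of_tgt _ _

/-- The kernel lies in `ν P₁`, hence is bounded below, and in each degree `p` presents a component
of the stalk of `M`, which is finitely presented. The extension property thus feeds the upward
induction. -/
lemma nonempty_homotopy_zero_kernel_nu (hI : Injective I) {M : ModuleCat.{u} R}
    (hM : Module.FinitePresentation R M) (p : ProjPresentation (stalk R M)) {X : Cplx R}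
    (hX : PureAcyclic X) (f : X ⟶ kernel ((nuCplx R I).map p.p)) : Nonempty (Homotopy f 0) := by
  obtain ⟨a, b, hP, -⟩ := p.proj₁.bounded
  have := isStrictlyGE_kernel_nu (I := I) p.p a
  refine nonempty_homotopy_zero_of_extension f a fun n m hnm u hu => ?_
  have := p.proj₁.finite m
  have := p.proj₀.finite m
  have := p.proj₁.projective m
  have := p.proj₀.projective m
  have := p.epi
  let ι : (kernel ((nuCplx R I).map p.p)).X m ⟶ (nu R I).obj (p.P₁.X m) :=
    (kernel.ι ((nuCplx R I).map p.p)).f m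
  have hι : ι ≫ (nu R I).map (p.p.f m) = 0 := kernel_ι_f_comp _ m
  obtain ⟨ψ, hψ, hdψ⟩ := exists_extension_to_ker_nu hI hX (p.p.f m) (p.π.f m) _ (exact_f p.exact m)
    (finitePresentation_stalk_X M hM m) hnm (u ≫ ι) (by rw [Category.assoc, hι, comp_zero])
    (by rw [reassoc_of% hu, zero_comp])
  obtain ⟨v, hv⟩ := exists_lift_kernel_f ((nuCplx R I).map p.p) m ψ hψ
  refine ⟨v, ?_⟩
  rw [← cancel_mono ((kernel.ι ((nuCplx R I).map p.p)).f m), Category.assoc, hv]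
  exact hdψ

lemma kpac_rightOrthogonal_kernel_nu (hI : Injective I) {M : ModuleCat.{u} R}
    (hM : Module.FinitePresentation R M) (p : ProjPresentation (stalk R M)) :
    (Kpac R).rightOrthogonal
      ((HomotopyCategory.quotient _ _).obj (kernel ((nuCplx R I).map p.p))) := by
  intro X f hX
  obtain ⟨f, rfl⟩ := (HomotopyCategory.quotient _ _).map_surjective f
  exact (HomotopyCategory.quotient_map_eq_zero_iff _).2
    (nonempty_homotopy_zero_kernel_nu hI hM p hX f)

lemma serreFinPres_le_rightOrthogonal (hI : Injective I) :
    serreFinPres R I ≤ (Kpac R).rightOrthogonal := by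
  rintro X ⟨M, hM, p, ⟨e⟩⟩
  exact (Kpac R).rightOrthogonal.prop_of_iso
    (((HomotopyCategory.quotient _ _).commShiftIso (2 : ℤ)).symm.app _ ≪≫ e.symm)
    ((Kpac R).rightOrthogonal.le_shift (2 : ℤ) _ (kpac_rightOrthogonal_kernel_nu hI hM p))

lemma coloc_kernel_nu {M : ModuleCat.{u} R} (hM : Module.FinitePresentation R M)
    (p : ProjPresentation (stalk R M)) : Coloc (serreFinPres R I)
      ((HomotopyCategory.quotient _ _).obj (kernel ((nuCplx R I).map p.p))) := by
  let N := kernel ((nuCplx R I).map p.p)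
  have h : Coloc (serreFinPres R I) (((HomotopyCategory.quotient _ _).obj N)⟦(2 : ℤ)⟧) :=
    le_coloc _ _ ⟨M, hM, p, ⟨((HomotopyCategory.quotient _ _).commShiftIso (2 : ℤ)).symm.app N⟩⟩
  exact (Coloc (serreFinPres R I)).prop_of_iso ((shiftEquiv (K R) (2 : ℤ)).unitIso.symm.app _)
    ((Coloc (serreFinPres R I)).le_shift (-2) _ h)

end SerreOrthogonal

/-! ### Contractible two-term complexes. -/

section Disc

open CochainComplex CochainComplex.HomComplex

variable {R : Type u} [Ring R] {Y Z : Cplx R} {i j : ℤ}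

lemma hom_ext_of_isDisc (hij : i + 1 = j) (hZ : ∀ n, n ≠ i → n ≠ j → IsZero (Z.X n))
    [Mono (Z.d i j)] {g g' : Y ⟶ Z} (h : g.f j = g'.f j) : g = g' := by
  ext1 n
  by_cases hj : n = j
  · rw [hj, h]
  by_cases hi : n = i
  · subst hi
    rw [← cancel_mono (Z.d n j), g.comm, g'.comm, h]
  exact (hZ n hi hj).eq_of_tgt _ _

/-- The chain map is the coboundary of the degree `-1` cochain whose only component is `φ` followed
by the inverse differential. It is therefore null-homotopic by construction. -/
lemma exists_hom_to_disc (hij : i + 1 = j) [IsIso (Z.d i j)] (φ : Y.X j ⟶ Z.X j) :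
    ∃ g : Y ⟶ Z, g.f j = φ ∧ Nonempty (Homotopy g 0) := by
  let α : Cochain Y Z (-1) := Cochain.single (p := j) (q := i) (φ ≫ inv (Z.d i j)) (-1)
  let z : Cocycle Y Z 0 := Cocycle.mk (δ (-1) 0 α) 1 rfl (δ_δ _ _ _ _)
  refine ⟨Cocycle.homOf z, ?_, ⟨(Cochain.equivHomotopy _ _).symm ⟨α, ?_⟩⟩⟩
  · change (δ (-1) 0 α).v j j (add_zero j) = φ
    rw [δ_v (-1) 0 (neg_add_cancel 1) _ j j (add_zero j) i (j + 1) (by lia) rfl,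
      Cochain.single_v, Cochain.single_v_eq_zero _ _ _ _ _ (by lia)]
    simp
  · rw [Cochain.ofHom_zero, add_zero, Cocycle.cochain_ofHom_homOf_eq_coe]
    rfl

/-- The contractible complex with the module `F` in the degrees `i` and `j = i + 1`. -/
noncomputable abbrev disc (F : ModuleCat.{u} R) (hij : i + 1 = j) : Cplx R :=
  HomologicalComplex.double (c := ComplexShape.up ℤ) (𝟙 F) hij

variable (F : ModuleCat.{u} R) (hij : i + 1 = j)

lemma isZero_disc_X (n : ℤ) (hi : n ≠ i) (hj : n ≠ j) : IsZero ((disc F hij).X n) :=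
  HomologicalComplex.isZero_double_X _ _ _ hi hj

/-- The isomorphism in the lower degree. -/
noncomputable abbrev discIso₀ : (disc F hij).X i ≅ F := HomologicalComplex.doubleXIso₀ _ _

/-- The isomorphism in the upper degree. -/
noncomputable abbrev discIso₁ : (disc F hij).X j ≅ F :=
  HomologicalComplex.doubleXIso₁ _ _ (by lia)

lemma disc_d : (disc F hij).d i j = (discIso₀ F hij).hom ≫ (discIso₁ F hij).inv := by
  refine (HomologicalComplex.double_d (c := ComplexShape.up ℤ) (𝟙 F) hij (by lia)).trans ?_
  rw [Category.id_comp]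

instance : IsIso ((disc F hij).d i j) := by
  rw [disc_d]
  infer_instance

/-- The map out of a disc attached to a map out of the module. -/
noncomputable def discDesc {K : Cplx R} (φ : F ⟶ K.X i) : disc F hij ⟶ K :=
  HomologicalComplex.mkHomFromDouble _ (by lia) φ (φ ≫ K.d i j) (by simp) (by simp)

lemma discDesc_f₀ {K : Cplx R} (φ : F ⟶ K.X i) :
    (discDesc F hij φ).f i = (discIso₀ F hij).hom ≫ φ :=
  HomologicalComplex.mkHomFromDouble_f₀ _ _ _ _ _ _

lemma discDesc_f₁ {K : Cplx R} (φ : F ⟶ K.X i) :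
    (discDesc F hij φ).f j = (discIso₁ F hij).hom ≫ φ ≫ K.d i j :=
  HomologicalComplex.mkHomFromDouble_f₁ _ _ _ _ _ _

lemma isContractibleProj_disc [Module.Finite R F] [Module.Projective R F] :
    IsContractibleProj (disc F hij) where
  bounded := ⟨i, j, (CochainComplex.isStrictlyGE_iff _ _).2 fun n hn =>
    isZero_disc_X F hij n (by lia) (by lia), (CochainComplex.isStrictlyLE_iff _ _).2 fun n hn =>
    isZero_disc_X F hij n (by lia) (by lia)⟩
  finite n := by
    by_cases hi : n = i
    · subst hi
      exact Module.Finite.equiv (discIso₀ F hij).toLinearEquiv.symm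
    by_cases hj : n = j
    · subst hj
      exact Module.Finite.equiv (discIso₁ F hij).toLinearEquiv.symm
    have := ModuleCat.subsingleton_of_isZero (isZero_disc_X F hij n hi hj)
    infer_instance
  projective n := by
    by_cases hi : n = i
    · subst hi
      exact Module.Projective.of_equiv (discIso₀ F hij).toLinearEquiv.symm
    by_cases hj : n = j
    · subst hj
      exact Module.Projective.of_equiv (discIso₁ F hij).toLinearEquiv.symm
    have := ModuleCat.subsingleton_of_isZero (isZero_disc_X F hij n hi hj)
    infer_instance
  contractible := by
    -- A map into a disc is determined by its upper component, so the null-homotopic map with upper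
    -- component `𝟙` is the identity.
    obtain ⟨g, hg, h⟩ := exists_hom_to_disc (Y := disc F hij) (Z := disc F hij) hij (𝟙 _)
    obtain rfl : g = 𝟙 _ := hom_ext_of_isDisc hij (isZero_disc_X F hij) hg
    exact h

lemma IsContractibleProj.biprod {P Q : Cplx R} (hP : IsContractibleProj P)
    (hQ : IsContractibleProj Q) : IsContractibleProj (P ⊞ Q) where
  bounded := by
    obtain ⟨a, b, _, _⟩ := hP.bounded
    obtain ⟨a', b', _, _⟩ := hQ.bounded
    have key (n : ℤ) (h : IsZero (P.X n)) (h' : IsZero (Q.X n)) : IsZero ((P ⊞ Q).X n) := by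
      rw [IsZero.iff_id_eq_zero, ← HomologicalComplex.id_f, ← biprod.total]
      rw [HomologicalComplex.add_f_apply, HomologicalComplex.comp_f, HomologicalComplex.comp_f,
        h.eq_of_src ((biprod.inl : P ⟶ P ⊞ Q).f n) 0,
        h'.eq_of_src ((biprod.inr : Q ⟶ P ⊞ Q).f n) 0]
      simp
    refine ⟨min a a', max b b', (CochainComplex.isStrictlyGE_iff _ _).2 fun n hn =>
      key n (P.isZero_of_isStrictlyGE a n (by lia)) (Q.isZero_of_isStrictlyGE a' n (by lia)),
      (CochainComplex.isStrictlyLE_iff _ _).2 fun n hn =>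
      key n (P.isZero_of_isStrictlyLE b n (by lia)) (Q.isZero_of_isStrictlyLE b' n (by lia))⟩
  finite n := by
    have := hP.finite n
    have := hQ.finite n
    exact Module.Finite.of_surjective
      (((biprod.inl : P ⟶ P ⊞ Q).f n).hom.coprod ((biprod.inr : Q ⟶ P ⊞ Q).f n).hom) fun x =>
      ⟨((biprod.fst : P ⊞ Q ⟶ P).f n x, (biprod.snd : P ⊞ Q ⟶ Q).f n x),
        ConcreteCategory.congr_hom (congrArg (fun f => HomologicalComplex.Hom.f f n)
          (biprod.total (X := P) (Y := Q))) x⟩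
  projective n := by
    have := hP.projective n
    have := hQ.projective n
    refine Module.Projective.of_split
      (((biprod.fst : P ⊞ Q ⟶ P).f n).hom.prod ((biprod.snd : P ⊞ Q ⟶ Q).f n).hom)
      (((biprod.inl : P ⟶ P ⊞ Q).f n).hom.coprod ((biprod.inr : Q ⟶ P ⊞ Q).f n).hom) ?_
    ext x
    exact ConcreteCategory.congr_hom (congrArg (fun f => HomologicalComplex.Hom.f f n)
      (biprod.total (X := P) (Y := Q))) x
  contractible := by
    obtain ⟨h⟩ := hP.contractible
    obtain ⟨h'⟩ := hQ.contractible
    refine ⟨(Homotopy.ofEq ?_).trans ((((h.compRight biprod.inl).compLeft biprod.fst).add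
      ((h'.compRight biprod.inr).compLeft biprod.snd)).trans (Homotopy.ofEq ?_))⟩
    · simp
    · simp

end Disc

/-! ### An explicit presentation of a stalk complex by discs. -/

section DiscPresentation

variable {R : Type u} [Ring R]

lemma exists_finite_projective_presentation (M : ModuleCat.{u} R)
    (hM : Module.FinitePresentation R M) :
    ∃ (F₁ F₀ : ModuleCat.{u} R) (g : F₁ ⟶ F₀) (π : F₀ ⟶ M) (w : g ≫ π = 0),
      Module.Finite R F₁ ∧ Module.Projective R F₁ ∧ Module.Finite R F₀ ∧ Module.Projective R F₀ ∧
      Epi π ∧ (ShortComplex.mk g π w).Exact := by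
  obtain ⟨n, N, e, hN⟩ := Module.FinitePresentation.exists_fin R M
  have : Module.Finite R N := Module.Finite.iff_fg.2 hN
  obtain ⟨m, f, hf⟩ := Module.Finite.exists_fin' R N
  let g : ModuleCat.of R (Fin m → R) ⟶ ModuleCat.of R (Fin n → R) :=
    ModuleCat.ofHom (N.subtype.comp f)
  let π : ModuleCat.of R (Fin n → R) ⟶ M := ModuleCat.ofHom (e.symm.toLinearMap.comp N.mkQ)
  have hπ (x : Fin n → R) : π x = 0 ↔ x ∈ N :=
    (e.symm.map_eq_zero_iff).trans (Submodule.Quotient.mk_eq_zero N)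
  have w : g ≫ π = 0 := by
    ext1
    exact LinearMap.ext fun x => (hπ _).2 (f x).2
  refine ⟨_, _, g, π, w, inferInstanceAs (Module.Finite R (Fin m → R)),
    inferInstanceAs (Module.Projective R (Fin m → R)), inferInstanceAs (Module.Finite R (Fin n → R)),
    inferInstanceAs (Module.Projective R (Fin n → R)),
    (ModuleCat.epi_iff_surjective _).2 (e.symm.surjective.comp N.mkQ_surjective),
    (ShortComplex.moduleCat_exact_iff _).2 fun x hx => ?_⟩
  obtain ⟨y, hy⟩ := hf ⟨x, (hπ x).1 hx⟩
  exact ⟨y, congrArg Subtype.val hy⟩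

variable {F₁ F₀ M : ModuleCat.{u} R} (g : F₁ ⟶ F₀) (π : F₀ ⟶ M)

/-- A map of modules as a map of discs. -/
noncomputable def discMap : disc F₁ (zero_add (1 : ℤ)) ⟶ disc F₀ (zero_add (1 : ℤ)) :=
  discDesc F₁ _ (g ≫ (discIso₀ F₀ _).inv)

lemma discMap_f₀ : (discMap g).f 0 = (discIso₀ F₁ _).hom ≫ g ≫ (discIso₀ F₀ _).inv :=
  discDesc_f₀ _ _ _

lemma discMap_f₁ : (discMap g).f 1 = (discIso₁ F₁ _).hom ≫ g ≫ (discIso₁ F₀ _).inv := by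
  rw [discMap, discDesc_f₁, disc_d, Category.assoc, Iso.inv_hom_id_assoc]

variable (F₀) in
/-- The map between consecutive discs which is the identity in the common degree. -/
noncomputable def discStep : disc F₀ one_add_one_eq_two ⟶ disc F₀ (zero_add (1 : ℤ)) :=
  discDesc F₀ _ (discIso₁ F₀ _).inv

lemma discStep_f : (discStep F₀).f 1 = (discIso₀ F₀ _).hom ≫ (discIso₁ F₀ _).inv :=
  discDesc_f₀ _ _ _

/-- The map from a disc to a stalk complex attached to a map of modules. -/
noncomputable def discToStalk : disc F₀ (zero_add (1 : ℤ)) ⟶ stalk R M :=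
  discDesc F₀ _ (π ≫ (HomologicalComplex.singleObjXSelf (ComplexShape.up ℤ) 0 M).inv)

lemma discToStalk_f : (discToStalk π).f 0 = (discIso₀ F₀ _).hom ≫ π ≫
    (HomologicalComplex.singleObjXSelf (ComplexShape.up ℤ) 0 M).inv :=
  discDesc_f₀ _ _ _

lemma isZero_stalk_X (n : ℤ) (hn : n ≠ 0) : IsZero ((stalk R M).X n) :=
  HomologicalComplex.isZero_single_obj_X _ _ _ _ hn

variable {g π}

lemma desc_comp_discToStalk (w : g ≫ π = 0) :
    biprod.desc (discMap g) (discStep F₀) ≫ discToStalk π = 0 := by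
  refine biprod.hom_ext' _ _ ?_ ?_
  · rw [biprod.inl_desc_assoc, comp_zero]
    refine HomologicalComplex.from_double_hom_ext ?_ ((isZero_stalk_X 1 one_ne_zero).eq_of_tgt _ _)
    rw [HomologicalComplex.comp_f, discMap_f₀, discToStalk_f]
    simp [reassoc_of% w]
  · rw [biprod.inr_desc_assoc, comp_zero]
    exact HomologicalComplex.from_double_hom_ext ((isZero_stalk_X 1 one_ne_zero).eq_of_tgt _ _)
      ((isZero_stalk_X 2 two_ne_zero).eq_of_tgt _ _)

lemma epi_discToStalk [Epi π] : Epi (discToStalk π) := by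
  have (n : ℤ) : Epi ((discToStalk π).f n) := by
    by_cases hn : n = 0
    · subst hn
      rw [discToStalk_f]
      infer_instance
    · exact ⟨fun _ _ _ => (isZero_stalk_X n hn).eq_of_src _ _⟩
  exact HomologicalComplex.epi_of_epi_f _ this

lemma exact_discToStalk (w : g ≫ π = 0) (h : (ShortComplex.mk g π w).Exact) :
    (ShortComplex.mk _ _ (desc_comp_discToStalk w)).Exact := by
  refine HomologicalComplex.exact_of_degreewise_exact _ fun n => ?_
  by_cases h₁ : n = 1
  · subst h₁
    -- The second disc is there for this degree: the stalk vanishes while `P₀` does not, and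
    -- `discStep` makes `p` surjective.
    refine (ShortComplex.moduleCat_exact_iff _).2 fun x _ =>
      ⟨(biprod.inr : _ ⟶ disc F₁ (zero_add (1 : ℤ)) ⊞ disc F₀ one_add_one_eq_two).f 1
        (((discIso₁ F₀ (zero_add (1 : ℤ))).hom ≫ (discIso₀ F₀ one_add_one_eq_two).inv) x), ?_⟩
    change (((discIso₁ F₀ (zero_add (1 : ℤ))).hom ≫ (discIso₀ F₀ one_add_one_eq_two).inv) ≫
      (biprod.inr ≫ biprod.desc (discMap g) (discStep F₀)).f 1) x = x
    rw [biprod.inr_desc, discStep_f]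
    simp only [Category.assoc, Iso.inv_hom_id_assoc, Iso.hom_inv_id]
    rfl
  by_cases h₀ : n = 0
  · subst h₀
    have h₂ : (ShortComplex.mk ((discMap g).f 0) ((discToStalk π).f 0) (by
        rw [discMap_f₀, discToStalk_f]
        simp [reassoc_of% w])).Exact := by
      refine ShortComplex.exact_of_iso (ShortComplex.isoMk (discIso₀ F₁ (zero_add (1 : ℤ))).symm
        (discIso₀ F₀ (zero_add (1 : ℤ))).symm
        (HomologicalComplex.singleObjXSelf (ComplexShape.up ℤ) 0 M).symm ?_ ?_) h
      · dsimp
        rw [discMap_f₀, Iso.inv_hom_id_assoc]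
      · dsimp
        rw [discToStalk_f, Iso.inv_hom_id_assoc]
    refine (ShortComplex.moduleCat_exact_iff _).2 fun x hx => ?_
    obtain ⟨y, hy⟩ := (ShortComplex.moduleCat_exact_iff _).1 h₂ x hx
    refine ⟨(biprod.inl : _ ⟶ disc F₁ (zero_add (1 : ℤ)) ⊞ disc F₀ one_add_one_eq_two).f 0 y, ?_⟩
    change (biprod.inl ≫ biprod.desc (discMap g) (discStep F₀)).f 0 y = x
    rw [biprod.inl_desc]
    exact hy
  · exact ShortComplex.exact_of_isZero_X₂ _ (isZero_disc_X F₀ (zero_add 1) n h₀ h₁)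

/-- The presentation of a stalk complex by discs. -/
noncomputable def discPresentation [Module.Finite R F₁] [Module.Projective R F₁]
    [Module.Finite R F₀] [Module.Projective R F₀] [Epi π] (w : g ≫ π = 0)
    (h : (ShortComplex.mk g π w).Exact) : ProjPresentation (stalk R M) where
  P₁ := disc F₁ (zero_add (1 : ℤ)) ⊞ disc F₀ one_add_one_eq_two
  P₀ := disc F₀ (zero_add (1 : ℤ))
  p := biprod.desc (discMap g) (discStep F₀)
  π := discToStalk π
  w := desc_comp_discToStalk w
  proj₁ := (isContractibleProj_disc _ _).biprod (isContractibleProj_disc _ _)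
  proj₀ := isContractibleProj_disc _ _
  epi := epi_discToStalk
  exact := exact_discToStalk w h

end DiscPresentation

/-! ### Detecting nonzero maps from stalks. -/

section Detection

variable {k : Type w} [CommRing k] {R : Type u} [Ring R] [Algebra k R] {I : ModuleCat.{u} k}

attribute [local instance] baseModule baseModule_isScalarTower

/-- The functionals which detect a class in degree `2`. -/
lemma exists_detecting_functionals (hI : Injective I) (hI' : IsCoseparator I) {F₁ F₀ M : ModuleCat.{u} R}
    {g : F₁ ⟶ F₀} {π : F₀ ⟶ M} (w : g ≫ π = 0) (h : (ShortComplex.mk g π w).Exact) [Epi π]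
    {X₁ X₂ : ModuleCat.{u} R} (d : X₁ ⟶ X₂) (f : M ⟶ X₂) (hf : ∀ s : M ⟶ X₁, s ≫ d ≠ f) :
    ∃ (l₁ : HomDual I F₁ X₁) (l₀ : HomDual I F₀ X₂), toNu l₁ ≫ (nu R I).map g = d ≫ toNu l₀ ∧
      l₀ (π ≫ f).hom ≠ 0 := by
  obtain ⟨l, hl, hlf⟩ := exists_functional_of_isCoseparator hI'
    (LinearMap.range (postcompₗ k M d)) f.hom (by
      rintro ⟨s, hs⟩
      exact hf (ModuleCat.ofHom s) (ModuleCat.hom_ext hs))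
  obtain ⟨l₀, hl₀⟩ := exists_extension_of_injective hI (precompₗ k π X₂) l (fun x hx => by
    have : ModuleCat.ofHom x = 0 := by
      rw [← cancel_epi π, comp_zero]
      exact ModuleCat.hom_ext hx
    rw [show x = 0 from congrArg ModuleCat.Hom.hom this, map_zero])
  -- A map `F₀ ⟶ X₁` killed by `g` factors through `M`. On its composite with `d`, the functional
  -- `l₀` agrees with `l` on a coboundary, hence is zero.
  obtain ⟨l₁, hl₁⟩ := exists_extension_of_injective hI (precompₗ k g X₁)
    (l₀.comp (postcompₗ k F₀ d)) (fun x hx => by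
      have hx' : g ≫ ModuleCat.ofHom x = 0 := ModuleCat.hom_ext hx
      have hx'' : π ≫ h.desc _ hx' = ModuleCat.ofHom x := h.g_desc _ hx'
      have := hl₀ (postcompₗ k M d (h.desc _ hx').hom)
      rw [hl _ ⟨_, rfl⟩] at this
      refine Eq.trans (congrArg l₀ ?_) this
      exact congrArg (fun t => (t ≫ d).hom) hx''.symm)
  refine ⟨l₁, l₀, ?_, ?_⟩
  · rw [toNu_comp_map, comp_toNu]
    congr 1
    exact LinearMap.ext hl₁
  · rw [show l₀ (π ≫ f).hom = l f.hom from hl₀ f.hom]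
    exact hlf

/-- Translate `s` into a functional `l` on `Hom(F₁, M)` and evaluate the resulting identity at `π`:
one side is `l (g ≫ π) = 0`, the other is `l₀ (π ≫ f)`. -/
lemma not_factors_of_detecting {F₁ F₀ M X₂ : ModuleCat.{u} R} {g : F₁ ⟶ F₀} {π : F₀ ⟶ M}
    [Module.Finite R F₁] [Module.Projective R F₁] [Module.Finite R F₀] [Module.Projective R F₀]
    (w : g ≫ π = 0) (f : M ⟶ X₂) (l₀ : HomDual I F₀ X₂) (hl₀ : l₀ (π ≫ f).hom ≠ 0)
    (s : M ⟶ (nu R I).obj F₁) : s ≫ (nu R I).map g ≠ f ≫ toNu l₀ := by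
  intro hs
  obtain ⟨l, rfl⟩ := toNu_surjective s
  rw [toNu_comp_map, comp_toNu] at hs
  have := LinearMap.congr_fun (toNu_injective hs) π.hom
  refine hl₀ (this.symm.trans ((congrArg l ?_).trans (map_zero l)))
  exact congrArg ModuleCat.Hom.hom w

/-- The complexes `E₁`, `E₂`, `E₀` stand for `ν` of the three discs, and `E` for `ν` of the direct
sum. Keeping the biproduct as bare data avoids identifying `ν` of a sum with a sum. -/
lemma exists_comp_kernel_ne_zero {X E E₁ E₂ E₀ : Cplx R} {G₁ G₀ M : ModuleCat.{u} R}
    (a₁ : E₁.X 1 ≅ G₁) (b₁ : E₂.X 1 ≅ G₀) (b₂ : E₂.X 2 ≅ G₀) (c₁ : E₀.X 1 ≅ G₀)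
    [IsIso (E₁.d 0 1)] [IsIso (E₂.d 1 2)] (hd : E₂.d 1 2 = b₁.hom ≫ b₂.inv) [IsIso (E₀.d 0 1)]
    (hE₀ : ∀ n, n ≠ 0 → n ≠ 1 → IsZero (E₀.X n)) (γ : G₁ ⟶ G₀)
    (m : E₁ ⟶ E₀) (hm : m.f 1 = a₁.hom ≫ γ ≫ c₁.inv)
    (σ : E₂ ⟶ E₀) (hσ : σ.f 1 = b₁.hom ≫ c₁.inv)
    (i₁ : E₁ ⟶ E) (i₂ : E₂ ⟶ E) (q₁ : E ⟶ E₁) (q₂ : E ⟶ E₂) (h₁₂ : i₁ ≫ q₂ = 0)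
    (h₂₂ : i₂ ≫ q₂ = 𝟙 _) (htotal : q₁ ≫ i₁ + q₂ ≫ i₂ = 𝟙 E)
    (p : E ⟶ E₀) (hp₁ : i₁ ≫ p = m) (hp₂ : i₂ ≫ p = σ)
    (l₁ : X.X 1 ⟶ G₁) (l₂ : X.X 2 ⟶ G₀) (hl : l₁ ≫ γ = X.d 1 2 ≫ l₂)
    {j : ℤ} (hj : 2 + 1 = j) (f : M ⟶ X.X 2) (hf : f ≫ X.d 2 j = 0)
    (hfl : ∀ s : M ⟶ G₁, s ≫ γ ≠ f ≫ l₂) :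
    ∃ t : X ⟶ kernel p, stalkHom f hj hf ≫ (HomotopyCategory.quotient _ _).map t ≠ 0 := by
  obtain ⟨t₁, ht₁, -⟩ := exists_hom_to_disc (Y := X) (zero_add 1) (l₁ ≫ a₁.inv)
  obtain ⟨t₂, ht₂, -⟩ := exists_hom_to_disc (Y := X) one_add_one_eq_two (l₂ ≫ b₂.inv)
  have ht₂' : t₂.f 1 = X.d 1 2 ≫ l₂ ≫ b₁.inv := by
    rw [← cancel_mono (E₂.d 1 2), t₂.comm, ht₂, hd]
    simp
  have ht : t₁ ≫ m = t₂ ≫ σ := by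
    refine hom_ext_of_isDisc (zero_add 1) hE₀ ?_
    rw [HomologicalComplex.comp_f, HomologicalComplex.comp_f, ht₁, ht₂', hm, hσ]
    simp [reassoc_of% hl]
  have htp : (t₁ ≫ i₁ - t₂ ≫ i₂) ≫ p = 0 := by
    rw [Preadditive.sub_comp, Category.assoc, Category.assoc, hp₁, hp₂, ht, sub_self]
  have htq : (t₁ ≫ i₁ - t₂ ≫ i₂) ≫ q₂ = -t₂ := by
    rw [Preadditive.sub_comp, Category.assoc, Category.assoc, h₁₂, h₂₂, comp_zero,
      Category.comp_id, zero_sub]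
  -- In degree `2` the `E₂`-component of the lift is `-l₂`, up to `b₂`. If its composite with `f`
  -- were a coboundary `s ≫ d`, the `E₂`-component of `s` would be `-(f ≫ l₂)`, and the kernel
  -- condition would make its `E₁`-component a factorization of `f ≫ l₂` through `γ`.
  refine ⟨kernel.lift p _ htp, fun h₀ => ?_⟩
  rw [stalkHom_comp, stalkHom_eq_zero_iff _ one_add_one_eq_two] at h₀
  obtain ⟨s, hs⟩ := h₀
  let r : kernel p ⟶ E₂ := kernel.ι p ≫ q₂
  have hr : r ≫ σ = -((kernel.ι p ≫ q₁) ≫ m) := by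
    have h : kernel.ι p ≫ (q₁ ≫ i₁ + q₂ ≫ i₂) ≫ p = 0 := by
      rw [htotal, Category.id_comp, kernel.condition]
    rw [Preadditive.add_comp, Preadditive.comp_add, Category.assoc, Category.assoc, hp₁, hp₂,
      add_comm] at h
    rw [← Category.assoc, ← Category.assoc] at h
    exact eq_neg_of_add_eq_zero_left h
  have hsr : (s ≫ r.f 1) ≫ b₁.hom = -(f ≫ l₂) := by
    have h : (s ≫ r.f 1) ≫ E₂.d 1 2 = -(f ≫ l₂ ≫ b₂.inv) := by
      rw [Category.assoc, r.comm, reassoc_of% hs, ← HomologicalComplex.comp_f,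
        kernel.lift_ι_assoc, htq, HomologicalComplex.neg_f_apply, ht₂, Preadditive.comp_neg]
    rw [hd] at h
    rw [← cancel_mono b₂.inv, Category.assoc, h]
    simp
  refine hfl ((s ≫ (kernel.ι p ≫ q₁).f 1) ≫ a₁.hom) ?_
  have h : s ≫ (r ≫ σ).f 1 = s ≫ (-((kernel.ι p ≫ q₁) ≫ m)).f 1 := by rw [hr]
  rw [HomologicalComplex.neg_f_apply, HomologicalComplex.comp_f _ m, HomologicalComplex.comp_f _ σ,
    hm, hσ, ← Category.assoc, ← Category.assoc, hsr, Preadditive.comp_neg, Preadditive.neg_comp,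
    neg_inj] at h
  rw [← cancel_mono c₁.inv, h]
  simp

/-- The complex `ν D` for a disc `D`. -/
noncomputable abbrev nuDisc (I : ModuleCat.{u} k) (F : ModuleCat.{u} R) {i j : ℤ} (hij : i + 1 = j) :
    Cplx R := (nuCplx R I).obj (disc F hij)

/-- The isomorphism in the lower degree. -/
noncomputable def nuDiscIso₀ (I : ModuleCat.{u} k) (F : ModuleCat.{u} R) {i j : ℤ}
    (hij : i + 1 = j) : (nuDisc I F hij).X i ≅ (nu R I).obj F :=
  (nu R I).mapIso (discIso₀ F hij)

/-- The isomorphism in the upper degree. -/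
noncomputable def nuDiscIso₁ (I : ModuleCat.{u} k) (F : ModuleCat.{u} R) {i j : ℤ}
    (hij : i + 1 = j) : (nuDisc I F hij).X j ≅ (nu R I).obj F :=
  (nu R I).mapIso (discIso₁ F hij)

lemma nuDisc_d (F : ModuleCat.{u} R) {i j : ℤ} (hij : i + 1 = j) :
    (nuDisc I F hij).d i j = (nuDiscIso₀ I F hij).hom ≫ (nuDiscIso₁ I F hij).inv :=
  (congrArg (nu R I).map (disc_d F hij)).trans ((nu R I).map_comp _ _)

instance (F : ModuleCat.{u} R) {i j : ℤ} (hij : i + 1 = j) : IsIso ((nuDisc I F hij).d i j) := by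
  rw [nuDisc_d]
  infer_instance

lemma exists_comp_kernel_nu_ne_zero (hI : Injective I) (hI' : IsCoseparator I)
    {F₁ F₀ M : ModuleCat.{u} R} {g : F₁ ⟶ F₀} {π : F₀ ⟶ M}
    [Module.Finite R F₁] [Module.Projective R F₁] [Module.Finite R F₀] [Module.Projective R F₀]
    [Epi π] (w : g ≫ π = 0) (h : (ShortComplex.mk g π w).Exact) {X : Cplx R}
    (f : stalkAt M 2 ⟶ (HomotopyCategory.quotient _ _).obj X) (hf : f ≠ 0) :
    ∃ t : X ⟶ kernel ((nuCplx R I).map (discPresentation w h).p),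
      f ≫ (HomotopyCategory.quotient _ _).map t ≠ 0 := by
  obtain ⟨f, hf', rfl⟩ := exists_eq_stalkHom (show (2 : ℤ) + 1 = 3 by norm_num) f
  obtain ⟨l₁, l₀, hl, hl₀⟩ := exists_detecting_functionals hI hI' w h (X.d 1 2) f fun s hs =>
    hf ((stalkHom_eq_zero_iff f one_add_one_eq_two _ _).2 ⟨s, hs⟩)
  let ν := nuCplx R I
  let D₁ := disc F₁ (zero_add (1 : ℤ))
  let D₂ := disc F₀ one_add_one_eq_two
  refine exists_comp_kernel_ne_zero (nuDiscIso₁ I F₁ _) (nuDiscIso₀ I F₀ one_add_one_eq_two)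
    (nuDiscIso₁ I F₀ _) (nuDiscIso₁ I F₀ _) (nuDisc_d _ _)
    (fun n h₀ h₁ => (nu R I).map_isZero (isZero_disc_X F₀ (zero_add 1) n h₀ h₁)) ((nu R I).map g)
    (ν.map (discMap g)) ?_ (ν.map (discStep F₀)) ?_
    (ν.map (biprod.inl : D₁ ⟶ D₁ ⊞ D₂)) (ν.map (biprod.inr : D₂ ⟶ D₁ ⊞ D₂)) (ν.map biprod.fst)
    (ν.map biprod.snd) ?_ ?_ ?_ _ ?_ ?_ (toNu l₁) (toNu l₀) hl _ f hf'
    (not_factors_of_detecting w f l₀ hl₀)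
  · refine (congrArg (nu R I).map (discMap_f₁ g)).trans ?_
    rw [Functor.map_comp, Functor.map_comp]
    rfl
  · exact (congrArg (nu R I).map discStep_f).trans ((nu R I).map_comp _ _)
  · rw [← Functor.map_comp, biprod.inl_snd, Functor.map_zero]
  · rw [← Functor.map_comp, biprod.inr_snd, CategoryTheory.Functor.map_id]
  · rw [← Functor.map_comp, ← Functor.map_comp, ← Functor.map_add, biprod.total,
      CategoryTheory.Functor.map_id]
  · exact (ν.map_comp _ _).symm.trans (congrArg ν.map (biprod.inl_desc _ _))
  · exact (ν.map_comp _ _).symm.trans (congrArg ν.map (biprod.inr_desc _ _))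

end Detection

/-! ### Transport of detection along shifts. -/

section Shift

variable {T : Type u} [Category.{v} T] [HasShift T ℤ] [Preadditive T]
  [∀ n : ℤ, (shiftFunctor T n).Additive]

lemma exists_comp_ne_zero_shift {C C' D : T} (n : ℤ) (e : C⟦n⟧ ≅ C')
    (h : ∀ (X : T) (f : C ⟶ X), f ≠ 0 → ∃ g : X ⟶ D, f ≫ g ≠ 0) (X : T) (f : C' ⟶ X)
    (hf : f ≠ 0) : ∃ g : X ⟶ D⟦n⟧, f ≫ g ≠ 0 := by
  let i : (X⟦-n⟧)⟦n⟧ ≅ X := (shiftFunctorCompIsoId T (-n) n (neg_add_cancel n)).app X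
  obtain ⟨f₀, hf₀⟩ := (shiftFunctor T n).map_surjective (e.hom ≫ f ≫ i.inv)
  have hf₀' : f₀ ≠ 0 := by
    rintro rfl
    rw [Functor.map_zero] at hf₀
    refine hf ?_
    rw [← cancel_epi e.hom, ← cancel_mono i.inv, Category.assoc, ← hf₀]
    simp
  obtain ⟨g, hg⟩ := h _ f₀ hf₀'
  refine ⟨i.inv ≫ g⟦n⟧', fun h₀ => hg ((shiftFunctor T n).map_injective ?_)⟩
  rw [Functor.map_comp, hf₀, Functor.map_zero, Category.assoc, Category.assoc, h₀, comp_zero]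

end Shift

/-! ### The second stable t-structure. -/

section StableTStructures

variable {k : Type w} [CommRing k] {R : Type u} [Ring R] [Algebra k R] {I : ModuleCat.{u} k}

lemma exists_coloc_detecting (hI : Injective I) (hI' : IsCoseparator I)
    (a : FinPresIndex R × ℤ) : ∃ D : K R, Coloc (serreFinPres R I) D ∧
      ∀ (X : K R) (f : finPresStalk a ⟶ X), f ≠ 0 → ∃ g : X ⟶ D, f ≫ g ≠ 0 := by
  obtain ⟨F₁, F₀, g, π, w, _, _, _, _, _, h⟩ :=
    exists_finite_projective_presentation a.1.module a.1.finitePresentation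
  -- The unshifted kernel detects stalks in degree `2`; shifting by `2 - a.2` reaches degree `a.2`.
  obtain ⟨e⟩ := nonempty_stalkAt_shift_iso a.1.module (2 - a.2) a.2 2 (by simp)
  refine ⟨_, (Coloc (serreFinPres R I)).le_shift (2 - a.2) _
    (coloc_kernel_nu a.1.finitePresentation (discPresentation w h)),
    exists_comp_ne_zero_shift _ e fun X f hf => ?_⟩
  obtain ⟨t, ht⟩ := exists_comp_kernel_nu_ne_zero hI hI' w h (X := X.as) f hf
  exact ⟨_, ht⟩

theorem isStableTStructure_coloc (hI : Injective I) (hI' : IsCoseparator I) :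
    IsStableTStructure (Kpac R) (Coloc (serreFinPres R I)) where
  left_isoClosed := inferInstance
  right_isoClosed := inferInstance
  left_triangulated := inferInstance
  right_triangulated := inferInstance
  hom_eq_zero _ _ hA hB f :=
    coloc_le_rightOrthogonal (Kpac R) (serreFinPres_le_rightOrthogonal hI) _ hB f hA
  exists_triangle X := by
    choose D hD hCD using exists_coloc_detecting (R := R) hI hI'
    obtain ⟨A, B, f, g, h, hA, hB, hT⟩ := exists_triangle_of_cogenerating
      (Coloc (serreFinPres R I)) (fun J => inferInstance) finPresStalk D hD
      exists_finPresStalk_iso_shift (fun X a f hf => ⟨a, hCD a X f hf⟩) X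
    exact ⟨A, B, f, g, h, (kpac_iff A).2 hA, hB, hT⟩

end StableTStructures

/-! ### An injective cogenerator over the integers. -/

section Cogenerator

/-- The rational circle, as a `ℤ`-module in an arbitrary universe. -/
abbrev ratCircle : ModuleCat.{u} ℤ := ModuleCat.of ℤ (ULift.{u} (AddCircle (1 : ℚ)))

lemma injective_ratCircle : Injective ratCircle.{u} := by
  have h := (Module.Baer.of_divisible (AddCircle (1 : ℚ))).of_equiv
    (ULift.moduleEquiv.{0, 0, u} (R := ℤ) (M := AddCircle (1 : ℚ))).symm
  exact Module.injective_object_of_injective_module (inj := h.injective)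

lemma isCoseparator_ratCircle : IsCoseparator ratCircle.{u} := by
  rw [Preadditive.isCoseparator_iff]
  intro X Y f hf
  ext x
  refine CharacterModule.eq_zero_of_character_apply fun c => ?_
  let c' : Y ⟶ ratCircle.{u} :=
    ModuleCat.ofHom
      { toFun := fun y => ULift.up (c y)
        map_add' := fun y z => congrArg ULift.up (map_add c y z)
        map_smul' := fun n y => congrArg ULift.up (map_intCast_smul c ℤ ℤ n y) }
  exact congrArg ULift.down (ConcreteCategory.congr_hom (hf c') x)

end Cogenerator

/-! ### Resolutions from truncation triangles. -/

section Resolutions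

variable {R : Type u} [Ring R]

lemma isPureQuasiIso_iff {X Y : Cplx R} (f : X ⟶ Y) :
    IsPureQuasiIso f ↔ (Kpac R).trW ((HomotopyCategory.quotient _ _).map f) :=
  ((Kpac R).trW_iff_of_distinguished _
    (HomotopyCategory.mappingCone_triangleh_distinguished f)).symm

lemma exists_pureProjectiveResolution (X : Cplx R) :
    ∃ (P : Cplx R) (f : P ⟶ X), IsPureProjectiveResolution f := by
  obtain ⟨A, B, f, g, h, hA, hB, hT⟩ :=
    (isStableTStructure_loc (R := R)).exists_triangle ((HomotopyCategory.quotient _ _).obj X)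
  obtain ⟨A, rfl⟩ := HomotopyCategory.quotient_obj_surjective A
  obtain ⟨f, rfl⟩ := (HomotopyCategory.quotient _ _).map_surjective f
  refine ⟨A, f, (isPureQuasiIso_iff f).2 (ObjectProperty.trW.mk _ hT hB), ?_⟩
  rw [isStableTStructure_loc.left_eq_leftPerp] at hA
  exact hA

lemma exists_pureInjectiveResolution (X : Cplx R) :
    ∃ (J : Cplx R) (f : X ⟶ J), IsPureInjectiveResolution f := by
  have hS := isStableTStructure_coloc (R := R) injective_ratCircle isCoseparator_ratCircle
  obtain ⟨A, B, f, g, h, hA, hB, hT⟩ :=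
    hS.exists_triangle ((HomotopyCategory.quotient _ _).obj X)
  obtain ⟨B, rfl⟩ := HomotopyCategory.quotient_obj_surjective B
  obtain ⟨g, rfl⟩ := (HomotopyCategory.quotient _ _).map_surjective g
  refine ⟨B, g, (isPureQuasiIso_iff g).2 (ObjectProperty.trW.mk' _ hT hA), ?_⟩
  rw [hS.right_eq_rightPerp] at hB
  exact hB

end Resolutions

end PureRes

theorem mainTheorem11 (R : Type u) [Ring R] :
    -- the first stable t-structure
    PureRes.IsStableTStructure (PureRes.Loc (PureRes.finPres R)) (PureRes.Kpac R) ∧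
    PureRes.Loc (PureRes.finPres R) = PureRes.HomotopicallyPureProjective R ∧
    ((PureRes.Loc (PureRes.finPres R)).ι ⋙ PureRes.toDpure R).IsEquivalence ∧
    (∃ L : PureRes.Dpure R ⥤ PureRes.K R, Nonempty (L ⊣ PureRes.toDpure R) ∧
      L.Full ∧ L.Faithful ∧ L.essImage = PureRes.HomotopicallyPureProjective R) ∧
    -- the second stable t-structure, for any base ring and any injective cogenerator
    (∀ (k : Type w) [CommRing k] [Algebra k R] (I : ModuleCat.{u} k),
      Injective I → IsCoseparator I →
      PureRes.IsStableTStructure (PureRes.Kpac R) (PureRes.Coloc (PureRes.serreFinPres R I)) ∧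
      PureRes.Coloc (PureRes.serreFinPres R I) = PureRes.HomotopicallyPureInjective R ∧
      ((PureRes.Coloc (PureRes.serreFinPres R I)).ι ⋙ PureRes.toDpure R).IsEquivalence) ∧
    (∃ G : PureRes.Dpure R ⥤ PureRes.K R, Nonempty (PureRes.toDpure R ⊣ G) ∧
      G.Full ∧ G.Faithful ∧ G.essImage = PureRes.HomotopicallyPureInjective R) ∧
    -- resolutions
    (∀ X : PureRes.Cplx R,
      (∃ (P : PureRes.Cplx R) (f : P ⟶ X), PureRes.IsPureProjectiveResolution f) ∧
      (∃ (I : PureRes.Cplx R) (f : X ⟶ I), PureRes.IsPureInjectiveResolution f)) := by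
  have hL := PureRes.isStableTStructure_loc (R := R)
  refine ⟨hL, hL.left_eq_leftPerp, hL.isEquivalence_left, ?_, fun k _ _ I hI hI' => ?_, ?_,
    fun X => ⟨PureRes.exists_pureProjectiveResolution X, PureRes.exists_pureInjectiveResolution X⟩⟩
  · obtain ⟨L, hL₁, hL₂, hL₃, hL₄⟩ := hL.exists_leftAdjoint
    exact ⟨L, hL₁, hL₂, hL₃, hL₄.trans hL.left_eq_leftPerp⟩
  · have hC := PureRes.isStableTStructure_coloc (R := R) hI hI'
    exact ⟨hC, hC.right_eq_rightPerp, hC.isEquivalence_right⟩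
  -- Every ring is a `ℤ`-algebra, so the base ring `ℤ` is always available for the right adjoint.
  · have hC := PureRes.isStableTStructure_coloc (R := R) PureRes.injective_ratCircle
      PureRes.isCoseparator_ratCircle
    obtain ⟨G, hG₁, hG₂, hG₃, hG₄⟩ := hC.exists_rightAdjoint
    exact ⟨G, hG₁, hG₂, hG₃, hG₄.trans hC.right_eq_rightPerp⟩
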